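/- Let $n\ge 3$ and give the edges of the complete directed graph on $n$ vertices (respectively, of the complete undirected graph on $n$ vertices) independent weights, exponentially distributed with mean $1$. Cycles are simple: directed cycles have length $k\ge 2$, undirected cycles have length $k\ge 3$. The mean weight of a cycle $C$ of length $k$ is $w(C)/k$, where $w(C)$ is the sum of the weights of its edges, and $C$ is called $c$-light if its mean weight is at most $c/n$. Put $L_0=L_0(n)=\log n/(2\log\log n)$. Fix a real number $c_0$. Regard the collection of $c_0$-light cycles of length at most $L_0$ as a point process $\xi_n$ on $\{\text{cycles}\}\times(-\infty,c_0]$, having one point $(C,\;n\,w(C)/|C|)$ for every $c_0$-light cycle $C$ of length $|C|\le L_0$, and let $\Lambda_n(B)=\mathbb E[\xi_n(B)]$ be its intensity, the expected number of such cycles with $(C,\;n\,w(C)/|C|)\in B$. Then, both for the directed and for the undirected complete graphs, for every $\varepsilon>0$ and all sufficiently large $n$: 1. the total variation distance between the law of $\xi_n$ and the law of the Poisson process with intensity measure $\Lambda_n$ is at most $\varepsilon$; 2. in particular, the edge weights and a Poisson process $\eta_n$ with intensity measure $\Lambda_n$ can be defined on a common probability space in such a way that, except with probability at most $\varepsilon$,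 simultaneously for all integers $k\le L_0$ and all real $c\le c_0$, the number of $c$-light cycles of length $k$ equals the number $\eta_n(\{C:|C|=k\}\times(-\infty,c])$ of points of the Poisson process in the corresponding region. -/

import Mathlib

open MeasureTheory ProbabilityTheory Filter
open scoped ENNReal

/-! ### Cycles of the complete graphs -/

/-- The edges of the complete directed graph on `V` (no loops). -/
abbrev DirEdge (V : Type*) : Type _ := {e : V × V // e.1 ≠ e.2}

/-- The edges of the complete undirected graph on `V` (no loops). -/
abbrev UndirEdge (V : Type*) : Type _ := {e : Sym2 V // ¬ e.IsDiag}

/-- The directed cycles of the complete directed graph on `V`, as edge sets: for some `k ≥ 2` and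
some sequence `v 0, …, v (k - 1)` of distinct vertices, the edges are `v 0 → v 1 → ⋯ → v 0`. -/
def dirCycles (V : Type*) : Set (Finset (DirEdge V)) :=
  {C | ∃ k : ℕ, 2 ≤ k ∧ ∃ v : ZMod k → V, Function.Injective v ∧
    Subtype.val '' (C : Set (DirEdge V)) = Set.range fun i : ZMod k => (v i, v (i + 1))}

/-- The undirected cycles of the complete undirected graph on `V`, as edge sets: for some `k ≥ 3`
and some sequence `v 0, …, v (k - 1)` of distinct vertices, the edges are
`{v 0, v 1}, {v 1, v 2}, …, {v (k - 1), v 0}`. -/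
def undirCycles (V : Type*) : Set (Finset (UndirEdge V)) :=
  {C | ∃ k : ℕ, 3 ≤ k ∧ ∃ v : ZMod k → V, Function.Injective v ∧
    Subtype.val '' (C : Set (UndirEdge V)) = Set.range fun i : ZMod k => s(v i, v (i + 1))}

/-! ### Light cycles

Below, `E` is the set of edges, a cycle is a finite set of edges (so that its length is its
cardinality), `𝒞` is the set of all cycles, `w` gives the edge weights and `n` is the number of
vertices. -/

/-- The mean weight of a cycle. -/
noncomputable def meanWeight {E : Type*} (w : E → ℝ) (C : Finset E) : ℝ :=
  (∑ e ∈ C, w e) / (C.card : ℝ)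

/-- A cycle is `c`-light if its mean weight is at most `c / n`. -/
def IsLight {E : Type*} (n : ℕ) (w : E → ℝ) (c : ℝ) (C : Finset E) : Prop :=
  meanWeight w C ≤ c / (n : ℝ)

/-- The length bound `L₀ = log n / (2 log log n)`. -/
noncomputable def shortLength (n : ℕ) : ℝ :=
  Real.log (n : ℝ) / (2 * Real.log (Real.log (n : ℝ)))

open Classical in
/-- The collection of the `c₀`-light cycles `C` of length at most `L₀`, each recorded together with
the level at which it becomes light: the point configuration (counting measure) having one point
`(C, n * meanWeight w C)` for every such cycle. -/
noncomputable def lightCycles {E : Type*} [Fintype E] (𝒞 : Set (Finset E)) (n : ℕ) (c₀ : ℝ)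
    (w : E → ℝ) : Measure (Finset E × ℝ) :=
  ∑ C : Finset E with C ∈ 𝒞 ∧ (C.card : ℝ) ≤ shortLength n ∧ IsLight n w c₀ C,
    Measure.dirac (C, (n : ℝ) * meanWeight w C)

/-- The joint law of i.i.d. exponential edge weights of mean `1`. -/
noncomputable def weightLaw (E : Type*) [Fintype E] : Measure (E → ℝ) :=
  Measure.pi fun _ => expMeasure 1

/-- The intensity: the expected number of short `c₀`-light cycles that fall into a given set. -/
noncomputable def lightIntensity {E : Type*} [Fintype E] (𝒞 : Set (Finset E)) (n : ℕ) (c₀ : ℝ) :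
    Measure (Finset E × ℝ) :=
  (weightLaw E).bind (lightCycles 𝒞 n c₀)

theorem measurable_meanWeight {E : Type*} (C : Finset E) :
    Measurable fun w : E → ℝ => meanWeight w C := by
  unfold meanWeight
  fun_prop

theorem measurable_lightCycles {E : Type*} [Fintype E] (𝒞 : Set (Finset E)) (n : ℕ) (c₀ : ℝ) :
    Measurable (lightCycles 𝒞 n c₀) := by
  classical
  refine Measure.measurable_of_measurable_coe _ fun B hB => ?_
  have h : ∀ w : E → ℝ, lightCycles 𝒞 n c₀ w B = ∑ C : Finset E,
      if C ∈ 𝒞 ∧ (C.card : ℝ) ≤ shortLength n ∧ IsLight n w c₀ C then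
        B.indicator (1 : Finset E × ℝ → ℝ≥0∞) (C, (n : ℝ) * meanWeight w C) else 0 := by
    intro w
    rw [lightCycles, Measure.coe_finsetSum, Finset.sum_apply, Finset.sum_filter]
    refine Finset.sum_congr rfl fun C _ => ?_
    rw [Measure.dirac_apply' _ hB]
  simp only [h]
  refine Finset.measurable_sum _ fun C _ => Measurable.ite ?_ ?_ measurable_const
  · exact (MeasurableSet.const (C ∈ 𝒞)).inter ((MeasurableSet.const _).inter
      (measurableSet_le (measurable_meanWeight C) measurable_const))
  · exact (measurable_one.indicator hB).comp
      (measurable_const.prodMk ((measurable_meanWeight C).const_mul (n : ℝ)))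

/-- The intensity of a set `B` is the expected number of short `c₀`-light cycles in `B`. -/
theorem lightIntensity_apply {E : Type*} [Fintype E] (𝒞 : Set (Finset E)) (n : ℕ) (c₀ : ℝ)
    {B : Set (Finset E × ℝ)} (hB : MeasurableSet B) :
    lightIntensity 𝒞 n c₀ B = ∫⁻ w, lightCycles 𝒞 n c₀ w B ∂(weightLaw E) :=
  Measure.bind_apply hB (measurable_lightCycles 𝒞 n c₀).aemeasurable

/-! ### Poisson processes and total variation -/

/-- `Q`, a probability measure on the space of measures on `X`, is the law of a Poisson process
with (σ-finite) intensity `Λ`: the number of points in a set of finite intensity has the Poisson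
distribution with that mean, and the numbers of points in finitely many disjoint sets are
independent. -/
structure IsPoissonProcessLaw {X : Type*} [MeasurableSpace X] (Λ : Measure X)
    (Q : Measure (Measure X)) : Prop where
  isProbabilityMeasure : IsProbabilityMeasure Q
  count_law : ∀ B : Set X, MeasurableSet B → Λ B ≠ ∞ →
    Q.map (fun ν => ν B) = (poissonMeasure (Λ B).toNNReal).map (fun k : ℕ => (k : ℝ≥0∞))
  indep : ∀ (m : ℕ) (B : Fin m → Set X), (∀ i, MeasurableSet (B i)) →
    Pairwise (Function.onFun Disjoint B) → iIndepFun (fun i (ν : Measure X) => ν (B i)) Q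

/-- Total variation distance of two probability measures: the largest difference of the
probabilities that they give to an event. -/
noncomputable def tvDist {X : Type*} [MeasurableSpace X] (μ ν : Measure X) : ℝ :=
  ⨆ A : {A : Set X // MeasurableSet A}, |μ.real A - ν.real A|

/-! ### Poisson processes of finite intensity -/

section Poisson

variable {X : Type*} [MeasurableSpace X]

/-- The character `ν ↦ exp (i ∑ⱼ tⱼ ν(Bⱼ))` on the space of measures. -/
noncomputable def countChar {m : ℕ} (t : Fin m → ℝ) (B : Fin m → Set X) (ν : Measure X) : ℂ :=
  Complex.exp ((∑ i, t i * ν.real (B i) : ℝ) * Complex.I)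

theorem measurable_measureReal {B : Set X} (hB : MeasurableSet B) :
    Measurable fun ν : Measure X => ν.real B :=
  (Measure.measurable_coe hB).ennreal_toReal

theorem measurable_countChar {m : ℕ} (t : Fin m → ℝ) {B : Fin m → Set X}
    (hB : ∀ i, MeasurableSet (B i)) : Measurable (countChar t B) := by
  have : Measurable fun ν : Measure X => (∑ i, t i * ν.real (B i) : ℝ) :=
    Finset.measurable_sum _ fun i _ => (measurable_measureReal (hB i)).const_mul _
  unfold countChar
  fun_prop

theorem norm_countChar {m : ℕ} (t : Fin m → ℝ) (B : Fin m → Set X) (ν : Measure X) :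
    ‖countChar t B ν‖ = 1 := by
  rw [countChar, Complex.norm_exp_ofReal_mul_I]

theorem integrable_countChar {m : ℕ} (t : Fin m → ℝ) {B : Fin m → Set X}
    (hB : ∀ i, MeasurableSet (B i)) (Q : Measure (Measure X)) [IsFiniteMeasure Q] :
    Integrable (countChar t B) Q :=
  Integrable.of_bound (measurable_countChar t hB).aestronglyMeasurable 1
    (Eventually.of_forall fun ν => (norm_countChar t B ν).le)

theorem countChar_zero {m : ℕ} (t : Fin m → ℝ) (B : Fin m → Set X) :
    countChar t B 0 = 1 := by
  simp [countChar]

theorem countChar_add {m : ℕ} (t : Fin m → ℝ) (B : Fin m → Set X) {μ ν : Measure X}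
    (hμ : μ Set.univ ≠ ∞) (hν : ν Set.univ ≠ ∞) :
    countChar t B (μ + ν) = countChar t B μ * countChar t B ν := by
  have : IsFiniteMeasure μ := ⟨hμ.lt_top⟩
  have : IsFiniteMeasure ν := ⟨hν.lt_top⟩
  rw [countChar, countChar, countChar, ← Complex.exp_add]
  congr 1
  rw [← add_mul, ← Complex.ofReal_add, ← Finset.sum_add_distrib]
  congr 3 with i
  rw [measureReal_add_apply, mul_add]

/-- The law of the sum of two independent random measures. -/
noncomputable def superpose (Q₁ Q₂ : Measure (Measure X)) : Measure (Measure X) :=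
  (Q₁.prod Q₂).map fun p => p.1 + p.2

theorem measurable_add_measure :
    Measurable fun p : Measure X × Measure X => p.1 + p.2 :=
  measurable_fst.add measurable_snd

instance (Q₁ Q₂ : Measure (Measure X)) [IsFiniteMeasure Q₁] [IsFiniteMeasure Q₂] :
    IsFiniteMeasure (superpose Q₁ Q₂) := by
  unfold superpose; infer_instance

theorem superpose_univ (Q₁ Q₂ : Measure (Measure X)) [IsFiniteMeasure Q₁] [IsFiniteMeasure Q₂] :
    superpose Q₁ Q₂ Set.univ = Q₁ Set.univ * Q₂ Set.univ := by
  rw [superpose, Measure.map_apply measurable_add_measure MeasurableSet.univ, Set.preimage_univ,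
    Measure.prod_apply MeasurableSet.univ]
  simp [mul_comm]

theorem ae_finite_superpose {Q₁ Q₂ : Measure (Measure X)} [IsFiniteMeasure Q₁]
    [IsFiniteMeasure Q₂] (h₁ : ∀ᵐ ν ∂Q₁, ν Set.univ ≠ ∞) (h₂ : ∀ᵐ ν ∂Q₂, ν Set.univ ≠ ∞) :
    ∀ᵐ ν ∂superpose Q₁ Q₂, ν Set.univ ≠ ∞ := by
  have hm : MeasurableSet {ν : Measure X | ν Set.univ ≠ ∞} :=
    (Measure.measurable_coe MeasurableSet.univ) (measurableSet_singleton ∞).compl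
  rw [superpose, ae_map_iff measurable_add_measure.aemeasurable hm]
  filter_upwards [Measure.quasiMeasurePreserving_fst.ae h₁,
    Measure.quasiMeasurePreserving_snd.ae h₂] with p hp1 hp2
  simp only [Measure.add_apply]
  exact ENNReal.add_ne_top.2 ⟨hp1, hp2⟩

theorem integral_countChar_superpose {Q₁ Q₂ : Measure (Measure X)} [IsFiniteMeasure Q₁]
    [IsFiniteMeasure Q₂] (h₁ : ∀ᵐ ν ∂Q₁, ν Set.univ ≠ ∞) (h₂ : ∀ᵐ ν ∂Q₂, ν Set.univ ≠ ∞)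
    {m : ℕ} (t : Fin m → ℝ) {B : Fin m → Set X} (hB : ∀ i, MeasurableSet (B i)) :
    ∫ ν, countChar t B ν ∂superpose Q₁ Q₂ =
      (∫ ν, countChar t B ν ∂Q₁) * ∫ ν, countChar t B ν ∂Q₂ := by
  rw [superpose, integral_map measurable_add_measure.aemeasurable
    (measurable_countChar t hB).aestronglyMeasurable, ← integral_prod_mul]
  refine integral_congr_ae ?_
  filter_upwards [Measure.quasiMeasurePreserving_fst.ae h₁,
    Measure.quasiMeasurePreserving_snd.ae h₂] with p hp1 hp2
  exact countChar_add t B hp1 hp2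

/-- `Q` is a probability measure on finite measures whose characteristic functionals are those of
a Poisson process with intensity `Λ`. -/
structure HasPoissonChar (Λ : Measure X) (Q : Measure (Measure X)) : Prop where
  isProbabilityMeasure : IsProbabilityMeasure Q
  ae_finite : ∀ᵐ ν ∂Q, ν Set.univ ≠ ∞
  integral_eq : ∀ (m : ℕ) (t : Fin m → ℝ) (B : Fin m → Set X), (∀ i, MeasurableSet (B i)) →
    ∫ ν, countChar t B ν ∂Q = Complex.exp (∫ x, (countChar t B (Measure.dirac x) - 1) ∂Λ)

theorem hasPoissonChar_zero : HasPoissonChar (0 : Measure X) (Measure.dirac 0) where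
  isProbabilityMeasure := inferInstance
  ae_finite := by
    have hm : MeasurableSet {ν : Measure X | ν Set.univ ≠ ∞} :=
      (Measure.measurable_coe MeasurableSet.univ) (measurableSet_singleton ∞).compl
    rw [ae_dirac_iff hm]; simp
  integral_eq m t B hB := by
    rw [integral_dirac' _ _ (measurable_countChar t hB).stronglyMeasurable]
    simp [countChar_zero]

theorem integrable_countChar_dirac_sub_one {m : ℕ} (t : Fin m → ℝ) {B : Fin m → Set X}
    (hB : ∀ i, MeasurableSet (B i)) (Λ : Measure X) [IsFiniteMeasure Λ] :
    Integrable (fun x => countChar t B (Measure.dirac x) - 1) Λ := by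
  refine Integrable.sub ?_ (integrable_const _)
  exact Integrable.of_bound ((measurable_countChar t hB).comp
    Measure.measurable_dirac).aestronglyMeasurable 1
    (Eventually.of_forall fun x => (norm_countChar t B _).le)

theorem HasPoissonChar.superpose {Λ₁ Λ₂ : Measure X} [IsFiniteMeasure Λ₁] [IsFiniteMeasure Λ₂]
    {Q₁ Q₂ : Measure (Measure X)} (h₁ : HasPoissonChar Λ₁ Q₁) (h₂ : HasPoissonChar Λ₂ Q₂) :
    HasPoissonChar (Λ₁ + Λ₂) (superpose Q₁ Q₂) := by
  have := h₁.isProbabilityMeasure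
  have := h₂.isProbabilityMeasure
  refine ⟨⟨by simp [superpose_univ]⟩, ae_finite_superpose h₁.ae_finite h₂.ae_finite,
    fun m t B hB => ?_⟩
  rw [integral_countChar_superpose h₁.ae_finite h₂.ae_finite t hB, h₁.integral_eq m t B hB,
    h₂.integral_eq m t B hB, ← Complex.exp_add,
    integral_add_measure (integrable_countChar_dirac_sub_one t hB _)
      (integrable_countChar_dirac_sub_one t hB _)]

/-- Convolution powers of the law of a single random point with (finite) law `Λ`. -/
noncomputable def pointsLaw (Λ : Measure X) : ℕ → Measure (Measure X)
  | 0 => Measure.dirac 0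
  | n + 1 => superpose (pointsLaw Λ n) (Λ.map Measure.dirac)

instance (Λ : Measure X) [IsFiniteMeasure Λ] (n : ℕ) : IsFiniteMeasure (pointsLaw Λ n) := by
  induction n with
  | zero => rw [pointsLaw]; infer_instance
  | succ n ih => rw [pointsLaw]; infer_instance

theorem pointsLaw_univ (Λ : Measure X) [IsFiniteMeasure Λ] (n : ℕ) :
    pointsLaw Λ n Set.univ = Λ Set.univ ^ n := by
  induction n with
  | zero => simp [pointsLaw]
  | succ n ih =>
    rw [pointsLaw, superpose_univ, ih, Measure.map_apply Measure.measurable_dirac .univ, pow_succ,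
      Set.preimage_univ]

theorem ae_finite_map_dirac (Λ : Measure X) : ∀ᵐ ν ∂Λ.map Measure.dirac, ν Set.univ ≠ ∞ := by
  have hm : MeasurableSet {ν : Measure X | ν Set.univ ≠ ∞} :=
    (Measure.measurable_coe MeasurableSet.univ) (measurableSet_singleton ∞).compl
  rw [ae_map_iff Measure.measurable_dirac.aemeasurable hm]
  simp

theorem ae_finite_pointsLaw (Λ : Measure X) [IsFiniteMeasure Λ] (n : ℕ) :
    ∀ᵐ ν ∂pointsLaw Λ n, ν Set.univ ≠ ∞ := by
  induction n with
  | zero => exact hasPoissonChar_zero.ae_finite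
  | succ n ih => exact ae_finite_superpose ih (ae_finite_map_dirac Λ)

theorem integral_countChar_pointsLaw (Λ : Measure X) [IsFiniteMeasure Λ] {m : ℕ}
    (t : Fin m → ℝ) {B : Fin m → Set X} (hB : ∀ i, MeasurableSet (B i)) (n : ℕ) :
    ∫ ν, countChar t B ν ∂pointsLaw Λ n = (∫ x, countChar t B (Measure.dirac x) ∂Λ) ^ n := by
  induction n with
  | zero =>
    rw [pointsLaw, integral_dirac' _ _ (measurable_countChar t hB).stronglyMeasurable,
      countChar_zero, pow_zero]
  | succ n ih =>
    rw [pointsLaw, integral_countChar_superpose (ae_finite_pointsLaw Λ n) (ae_finite_map_dirac Λ)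
      t hB, ih, pow_succ, integral_map Measure.measurable_dirac.aemeasurable
        (measurable_countChar t hB).aestronglyMeasurable]

/-- The law of the Poisson process of finite intensity `Λ`: a Poisson number of independent
points. -/
noncomputable def poissonLaw (Λ : Measure X) : Measure (Measure X) :=
  Measure.sum fun n : ℕ =>
    (ENNReal.ofReal (Real.exp (-(Λ.real Set.univ))) / (n.factorial : ℝ≥0∞)) • pointsLaw Λ n

theorem ofReal_exp_neg_mul_tsum (p : ℝ) (hp : 0 ≤ p) :
    ∑' n : ℕ, ENNReal.ofReal (Real.exp (-p)) / (n.factorial : ℝ≥0∞) * ENNReal.ofReal p ^ n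
      = 1 := by
  lift p to NNReal using hp
  have hp : (0 : ℝ) ≤ p := p.2
  have h := hasSum_one_poissonMeasure p
  rw [← ENNReal.ofReal_one, ← h.tsum_eq, ENNReal.ofReal_tsum_of_nonneg (fun n => by positivity)
    h.summable]
  refine tsum_congr fun n => ?_
  have hf : (0 : ℝ) < n.factorial := by positivity
  rw [ENNReal.ofReal_div_of_pos hf, ENNReal.ofReal_mul (by positivity), ENNReal.ofReal_natCast]
  rw [ENNReal.ofReal_pow hp, ENNReal.div_eq_inv_mul, ENNReal.div_eq_inv_mul, mul_assoc]

theorem isProbabilityMeasure_poissonLaw (Λ : Measure X) [IsFiniteMeasure Λ] :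
    IsProbabilityMeasure (poissonLaw Λ) := by
  constructor
  rw [poissonLaw, Measure.sum_apply _ .univ]
  simp only [Measure.smul_apply, pointsLaw_univ, smul_eq_mul]
  rw [← ofReal_exp_neg_mul_tsum (Λ.real Set.univ) measureReal_nonneg,
    ofReal_measureReal]

theorem hasPoissonChar_poissonLaw (Λ : Measure X) [IsFiniteMeasure Λ] :
    HasPoissonChar Λ (poissonLaw Λ) := by
  have := isProbabilityMeasure_poissonLaw Λ
  refine ⟨inferInstance, ?_, fun m t B hB => ?_⟩
  · rw [poissonLaw, Measure.ae_sum_iff]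
    exact fun n => Measure.ae_smul_measure (ae_finite_pointsLaw Λ n) _
  have h1 := hasSum_integral_measure (integrable_countChar t hB (poissonLaw Λ))
  set z := ∫ x, countChar t B (Measure.dirac x) ∂Λ with hz
  set p := Λ.real Set.univ with hp
  have h2 : HasSum (fun n : ℕ => (Real.exp (-p) : ℂ) * (z ^ n / n.factorial))
      (Real.exp (-p) * Complex.exp z) := by
    have := NormedSpace.expSeries_div_hasSum_exp z
    rw [← Complex.exp_eq_exp_ℂ] at this
    exact this.mul_left _
  have h3 : ∫ x, (countChar t B (Measure.dirac x) - 1) ∂Λ = z - p := by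
    have hi : Integrable (fun x => countChar t B (Measure.dirac x)) Λ :=
      Integrable.of_bound ((measurable_countChar t hB).comp
        Measure.measurable_dirac).aestronglyMeasurable 1
        (Eventually.of_forall fun x => (norm_countChar t B _).le)
    rw [integral_sub hi (integrable_const _)]
    simp [hz, hp]
  rw [h3, sub_eq_neg_add, Complex.exp_add]
  have h4 : Complex.exp (-(p : ℂ)) = (Real.exp (-p) : ℂ) := by push_cast; rfl
  rw [h4]
  refine h1.unique ?_
  convert! h2 using 1
  ext n
  rw [integral_smul_measure, integral_countChar_pointsLaw Λ t hB, ENNReal.toReal_div,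
    ENNReal.toReal_ofReal (Real.exp_pos _).le, ENNReal.toReal_natCast, Complex.real_smul]
  push_cast
  ring

theorem superpose_zero_left (Q : Measure (Measure X)) [IsFiniteMeasure Q] :
    superpose (Measure.dirac 0) Q = Q := by
  rw [superpose, Measure.dirac_prod, Measure.map_map measurable_add_measure (by fun_prop)]
  simp [Function.comp_def]

/-- The contribution of at most one point to the Poisson process. -/
theorem le_poissonLaw_apply (Λ : Measure X) [IsFiniteMeasure Λ] (A : Set (Measure X)) :
    ENNReal.ofReal (Real.exp (-(Λ.real Set.univ))) *
      (Measure.dirac 0 A + Λ.map Measure.dirac A) ≤ poissonLaw Λ A := by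
  refine le_trans ?_ (Measure.le_sum_apply _ _)
  refine le_trans (le_of_eq ?_) (ENNReal.sum_le_tsum (Finset.range 2))
  simp [Finset.sum_range_succ, pointsLaw, superpose_zero_left, mul_add]

end Poisson

section PoissonLaw

variable {X : Type*} [MeasurableSpace X]

theorem dirac_real_apply {B : Set X} (hB : MeasurableSet B) (x : X) :
    (Measure.dirac x).real B = B.indicator 1 x := by
  classical
  rw [measureReal_def, Measure.dirac_apply' _ hB]
  by_cases hx : x ∈ B <;> simp [hx]

theorem countChar_dirac_sub_one {m : ℕ} (t : Fin m → ℝ) {B : Fin m → Set X}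
    (hB : ∀ i, MeasurableSet (B i)) (hd : Pairwise (Function.onFun Disjoint B)) (x : X) :
    countChar t B (Measure.dirac x) - 1 =
      ∑ i, (B i).indicator (fun _ => Complex.exp (t i * Complex.I) - 1) x := by
  simp only [countChar, dirac_real_apply (hB _)]
  by_cases hx : ∃ j, x ∈ B j
  · obtain ⟨j, hj⟩ := hx
    have hne : ∀ i, i ≠ j → x ∉ B i := fun i hi h => (hd hi).notMem_of_mem_left h hj
    rw [Finset.sum_eq_single j (fun i _ hi => by simp [hne i hi]) (by simp),
      Finset.sum_eq_single j (fun i _ hi => by simp [hne i hi]) (by simp)]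
    simp [hj]
  · push Not at hx
    simp [hx]

theorem integral_countChar_dirac_sub_one (Λ : Measure X) [IsFiniteMeasure Λ] {m : ℕ}
    (t : Fin m → ℝ) {B : Fin m → Set X}
    (hB : ∀ i, MeasurableSet (B i)) (hd : Pairwise (Function.onFun Disjoint B)) :
    ∫ x, (countChar t B (Measure.dirac x) - 1) ∂Λ =
      ∑ i, (Λ.real (B i) : ℂ) * (Complex.exp (t i * Complex.I) - 1) := by
  simp only [countChar_dirac_sub_one t hB hd]
  rw [integral_finsetSum _ fun i _ => (integrable_const _).indicator (hB i)]
  refine Finset.sum_congr rfl fun i _ => ?_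
  rw [integral_indicator (hB i), setIntegral_const, Complex.real_smul]

theorem HasPoissonChar.map_real_eq {Λ : Measure X} [IsFiniteMeasure Λ] {Q : Measure (Measure X)}
    (h : HasPoissonChar Λ Q) {B : Set X} (hB : MeasurableSet B) :
    Q.map (fun ν => ν.real B) = (poissonMeasure (Λ B).toNNReal).map (fun k : ℕ => (k : ℝ)) := by
  have := h.isProbabilityMeasure
  have : IsProbabilityMeasure (Q.map (fun ν => ν.real B)) :=
    Measure.isProbabilityMeasure_map (measurable_measureReal hB).aemeasurable
  refine Measure.ext_of_charFun (funext fun t => ?_)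
  rw [charFun_map_cast_poissonMeasure, charFun_apply_real,
    integral_map (measurable_measureReal hB).aemeasurable (by fun_prop)]
  have h1 := h.integral_eq 1 (fun _ => t) (fun _ => B) (fun _ => hB)
  rw [integral_countChar_dirac_sub_one Λ _ (fun _ => hB)
    (fun i j hij => (hij (Subsingleton.elim i j)).elim)] at h1
  simp only [countChar, Finset.univ_unique, Finset.sum_singleton] at h1
  push_cast at h1
  exact h1

theorem HasPoissonChar.iIndepFun_real {Λ : Measure X} [IsFiniteMeasure Λ]
    {Q : Measure (Measure X)} (h : HasPoissonChar Λ Q) {m : ℕ} {B : Fin m → Set X}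
    (hB : ∀ i, MeasurableSet (B i)) (hd : Pairwise (Function.onFun Disjoint B)) :
    iIndepFun (fun i (ν : Measure X) => ν.real (B i)) Q := by
  have := h.isProbabilityMeasure
  rw [iIndepFun_iff_charFun_pi fun i => (measurable_measureReal (hB i)).aemeasurable]
  intro t
  simp only [h.map_real_eq (hB _), charFun_map_cast_poissonMeasure]
  rw [← Complex.exp_sum, charFun_apply, integral_map]
  · have h1 := h.integral_eq m (fun i => t i) B hB
    rw [integral_countChar_dirac_sub_one Λ _ hB hd] at h1
    convert! h1 using 2
  · have : Measurable fun ν : Measure X => fun i => ν.real (B i) :=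
      measurable_pi_lambda _ fun i => measurable_measureReal (hB i)
    exact ((WithLp.measurable_toLp 2 _).comp this).aemeasurable
  · fun_prop

theorem HasPoissonChar.isPoissonProcessLaw {Λ : Measure X} [IsFiniteMeasure Λ]
    {Q : Measure (Measure X)} (h : HasPoissonChar Λ Q) : IsPoissonProcessLaw Λ Q := by
  have := h.isProbabilityMeasure
  have hae : ∀ B : Set X, (fun ν : Measure X => ENNReal.ofReal (ν.real B)) =ᵐ[Q] fun ν => ν B := by
    intro B
    filter_upwards [h.ae_finite] with ν hν
    exact ENNReal.ofReal_toReal (measure_ne_top_of_subset (Set.subset_univ B) hν)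
  refine ⟨inferInstance, fun B hB _ => ?_, fun m B hB hd => ?_⟩
  · rw [← Measure.map_congr (hae B)]
    have h1 : (fun ν : Measure X => ENNReal.ofReal (ν.real B)) =
      ENNReal.ofReal ∘ fun ν : Measure X => ν.real B := rfl
    rw [h1, ← Measure.map_map ENNReal.measurable_ofReal (measurable_measureReal hB),
      h.map_real_eq hB, Measure.map_map ENNReal.measurable_ofReal (by fun_prop)]
    congr 1
    ext k
    simp
  · exact ((h.iIndepFun_real hB hd).comp (fun _ => ENNReal.ofReal)
      fun _ => ENNReal.measurable_ofReal).congr fun i => hae (B i)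

/-- The part of the space that lies in exactly those sets `B` of the family with `σ B`. -/
def atomOf {Y ι : Type*} (B : ι → Set Y) (σ : ι → Bool) : Set Y :=
  ⋂ i, if σ i then B i else (B i)ᶜ

theorem mem_atomOf {Y ι : Type*} {B : ι → Set Y} {σ : ι → Bool} {x : Y} :
    x ∈ atomOf B σ ↔ ∀ i, (x ∈ B i ↔ σ i) := by
  simp only [atomOf, Set.mem_iInter]
  refine forall_congr' fun i => ?_
  cases σ i <;> simp

theorem measurableSet_atomOf {ι : Type*} [Finite ι] {B : ι → Set X}
    (hB : ∀ i, MeasurableSet (B i)) (σ : ι → Bool) : MeasurableSet (atomOf B σ) := by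
  refine MeasurableSet.iInter fun i => ?_
  split_ifs
  exacts [hB i, (hB i).compl]

theorem pairwise_disjoint_atomOf {Y ι : Type*} (B : ι → Set Y) :
    Pairwise (Function.onFun Disjoint (atomOf B)) := by
  intro σ τ h
  refine Set.disjoint_left.2 fun x hσ hτ => h (funext fun i => ?_)
  have h1 := mem_atomOf.1 hσ i
  have h2 := mem_atomOf.1 hτ i
  exact Bool.eq_iff_iff.2 (h1.symm.trans h2)

theorem measure_eq_sum_atomOf {ι : Type*} [Fintype ι] [DecidableEq ι] {B : ι → Set X}
    (hB : ∀ i, MeasurableSet (B i)) (ν : Measure X) (i : ι) :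
    ν (B i) = ∑ σ : ι → Bool with σ i, ν (atomOf B σ) := by
  classical
  rw [← measure_biUnion_finset (fun σ _ τ _ h => pairwise_disjoint_atomOf B h)
    fun σ _ => measurableSet_atomOf hB σ]
  congr 1
  ext x
  simp only [Finset.mem_filter, Finset.mem_univ, true_and, Set.mem_iUnion, mem_atomOf,
    exists_prop]
  constructor
  · intro hx
    exact ⟨fun j => decide (x ∈ B j), by simp [hx], by simp⟩
  · rintro ⟨σ, h1, h2⟩
    exact (h2 i).2 h1

theorem IsPoissonProcessLaw.map_counts_eq {Λ : Measure X} [IsFiniteMeasure Λ]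
    {Q Q' : Measure (Measure X)} (h : IsPoissonProcessLaw Λ Q) (h' : IsPoissonProcessLaw Λ Q')
    {κ : Type*} [Fintype κ] {B : κ → Set X}
    (hB : ∀ i, MeasurableSet (B i)) (hd : Pairwise (Function.onFun Disjoint B)) :
    Q.map (fun ν i => ν (B i)) = Q'.map (fun ν i => ν (B i)) := by
  have := h.isProbabilityMeasure
  have := h'.isProbabilityMeasure
  have hm : ∀ i, Measurable fun ν : Measure X => ν (B i) := fun i => Measure.measurable_coe (hB i)
  let e := Fintype.equivFin κ
  have key : ∀ R : Measure (Measure X), IsPoissonProcessLaw Λ R →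
      iIndepFun (fun i (ν : Measure X) => ν (B i)) R := fun R hR => by
    have h1 := hR.indep _ (fun j => B (e.symm j)) (fun _ => hB _)
      (fun i j hij => hd (e.symm.injective.ne hij))
    have h2 := h1.precomp e.injective
    simpa using h2
  rw [(iIndepFun_iff_map_fun_eq_pi_map fun i => (hm i).aemeasurable).1 (key Q h),
    (iIndepFun_iff_map_fun_eq_pi_map fun i => (hm i).aemeasurable).1 (key Q' h')]
  congr 1
  ext1 i
  rw [h.count_law _ (hB i) (measure_ne_top _ _), h'.count_law _ (hB i) (measure_ne_top _ _)]

/-- The law of a Poisson process of finite intensity is unique. -/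
theorem IsPoissonProcessLaw.unique {Λ : Measure X} [IsFiniteMeasure Λ]
    {Q Q' : Measure (Measure X)} (h : IsPoissonProcessLaw Λ Q) (h' : IsPoissonProcessLaw Λ Q') :
    Q = Q' := by
  classical
  have := h.isProbabilityMeasure
  have := h'.isProbabilityMeasure
  let m : {B : Set X // MeasurableSet B} → MeasurableSpace (Measure X) :=
    fun B => (borel ℝ≥0∞).comap fun ν => ν B.1
  have hgen : (Measure.instMeasurableSpace : MeasurableSpace (Measure X)) =
      MeasurableSpace.generateFrom
        (piiUnionInter (fun B => {s | MeasurableSet[m B] s}) Set.univ) := by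
    rw [generateFrom_piiUnionInter_measurableSet m, Measure.instMeasurableSpace]
    simp only [Set.mem_univ, iSup_pos, m, iSup_subtype]
  refine ext_of_generate_finite _ hgen
    (isPiSystem_piiUnionInter _ (fun B => @MeasurableSpace.isPiSystem_measurableSet _ (m B)) _)
    ?_ (by simp)
  rintro _ ⟨T, -, f, hf, rfl⟩
  choose! S hS hSf using hf
  let B : T → Set X := fun i => i.1.1
  have hB : ∀ i, MeasurableSet (B i) := fun i => i.1.2
  have hmap := h.map_counts_eq h' (B := atomOf B) (fun σ => measurableSet_atomOf hB σ)
    (pairwise_disjoint_atomOf B)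
  let D : Set ((T → Bool) → ℝ≥0∞) := ⋂ i : T, {y | ∑ σ : T → Bool with σ i, y σ ∈ S i.1}
  have hD : MeasurableSet D := by
    refine MeasurableSet.iInter fun i => ?_
    have : Measurable fun y : (T → Bool) → ℝ≥0∞ => ∑ σ : T → Bool with σ i, y σ :=
      Finset.measurable_sum _ fun σ _ => measurable_pi_apply σ
    have hSm := hS i.1 i.2
    rw [← BorelSpace.measurable_eq (α := ℝ≥0∞)] at hSm
    exact this hSm
  have hpre : (⋂ x ∈ T, f x) = (fun (ν : Measure X) σ => ν (atomOf B σ)) ⁻¹' D := by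
    ext ν
    simp only [Set.mem_iInter, Set.mem_preimage, D, Set.mem_ofPred_eq, ← measure_eq_sum_atomOf hB]
    constructor
    · intro hν i
      have := hν i.1 i.2
      rw [← hSf i.1 i.2] at this
      exact this
    · intro hν i hi
      rw [← hSf i hi]
      exact hν ⟨i, hi⟩
  have hJ : Measurable fun (ν : Measure X) σ => ν (atomOf B σ) :=
    measurable_pi_lambda _ fun σ => Measure.measurable_coe (measurableSet_atomOf hB σ)
  rw [hpre, ← Measure.map_apply hJ hD, ← Measure.map_apply hJ hD, hmap]

end PoissonLaw

/-! ### Comparison of probability measures up to an error -/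

section LeUpTo

variable {Y Z : Type*} [MeasurableSpace Y] [MeasurableSpace Z]

/-- `μ` exceeds `ν` on no event by more than `δ`. -/
def LeUpTo (μ ν : Measure Y) (δ : ℝ≥0∞) : Prop :=
  ∀ A, MeasurableSet A → μ A ≤ ν A + δ

theorem LeUpTo.trans {μ ν ρ : Measure Y} {δ δ' : ℝ≥0∞} (h : LeUpTo μ ν δ) (h' : LeUpTo ν ρ δ') :
    LeUpTo μ ρ (δ + δ') := fun A hA => by
  refine (h A hA).trans ?_
  rw [add_comm δ, ← add_assoc]
  gcongr
  exact h' A hA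

theorem LeUpTo.map {μ ν : Measure Y} {δ : ℝ≥0∞} (h : LeUpTo μ ν δ) {f : Y → Z}
    (hf : Measurable f) : LeUpTo (μ.map f) (ν.map f) δ := fun A hA => by
  rw [Measure.map_apply hf hA, Measure.map_apply hf hA]
  exact h _ (hf hA)

theorem LeUpTo.prod {μ₁ ν₁ : Measure Y} {μ₂ ν₂ : Measure Z} [IsProbabilityMeasure μ₁]
    [IsProbabilityMeasure ν₁] [IsProbabilityMeasure μ₂] [IsProbabilityMeasure ν₂]
    {δ₁ δ₂ : ℝ≥0∞} (h₁ : LeUpTo μ₁ ν₁ δ₁) (h₂ : LeUpTo μ₂ ν₂ δ₂) :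
    LeUpTo (μ₁.prod μ₂) (ν₁.prod ν₂) (δ₁ + δ₂) := by
  have hA1 : LeUpTo (μ₁.prod μ₂) (ν₁.prod μ₂) δ₁ := fun A hA => by
    rw [Measure.prod_apply_symm hA, Measure.prod_apply_symm hA]
    calc _ ≤ ∫⁻ y, (ν₁ ((fun x => (x, y)) ⁻¹' A) + δ₁) ∂μ₂ :=
          lintegral_mono fun y => h₁ _ (measurable_prodMk_right hA)
      _ = _ := by rw [lintegral_add_right _ measurable_const]; simp
  have hA2 : LeUpTo (ν₁.prod μ₂) (ν₁.prod ν₂) δ₂ := fun A hA => by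
    rw [Measure.prod_apply hA, Measure.prod_apply hA]
    calc _ ≤ ∫⁻ x, (ν₂ (Prod.mk x ⁻¹' A) + δ₂) ∂ν₁ :=
          lintegral_mono fun x => h₂ _ (measurable_prodMk_left hA)
      _ = _ := by rw [lintegral_add_right _ measurable_const]; simp
  exact hA1.trans hA2

theorem LeUpTo.symm {μ ν : Measure Y} [IsProbabilityMeasure μ] [IsProbabilityMeasure ν]
    {δ : ℝ≥0∞} (h : LeUpTo μ ν δ) : LeUpTo ν μ δ := fun A hA => by
  have h1 := h _ hA.compl
  have h2 : ν A + ν Aᶜ = μ A + μ Aᶜ := by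
    rw [measure_add_measure_compl hA, measure_add_measure_compl hA, measure_univ, measure_univ]
  refine ENNReal.le_of_add_le_add_right (measure_ne_top ν Aᶜ) ?_
  rw [h2, add_assoc, add_comm δ]
  gcongr

theorem LeUpTo.tvDist_le {μ ν : Measure Y} [IsProbabilityMeasure μ] [IsProbabilityMeasure ν]
    {δ : ℝ} (hδ : 0 ≤ δ) (h : LeUpTo μ ν (ENNReal.ofReal δ)) : tvDist μ ν ≤ δ := by
  have key : ∀ {μ ν : Measure Y} [IsProbabilityMeasure μ] [IsProbabilityMeasure ν],
      LeUpTo μ ν (ENNReal.ofReal δ) → ∀ A, MeasurableSet A → μ.real A ≤ ν.real A + δ := by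
    intro μ ν _ _ h A hA
    have := ENNReal.toReal_mono (by finiteness) (h A hA)
    rwa [ENNReal.toReal_add (by finiteness) (by finiteness), ENNReal.toReal_ofReal hδ] at this
  have : Nonempty {A : Set Y // MeasurableSet A} := ⟨⟨∅, .empty⟩⟩
  refine ciSup_le fun A => abs_sub_le_iff.2 ⟨?_, ?_⟩
  · linarith [key h A A.2]
  · linarith [key h.symm A A.2]

end LeUpTo

/-! ### Decoupling -/

section Decoupling

variable {Ω Y Z : Type*} [MeasurableSpace Ω] [MeasurableSpace Y] [MeasurableSpace Z]

/-- If `S` agrees off `U` with a variable `S'` that is independent of `M`, then `(S, M)` is close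
in law to a pair with the same marginals and independent components. -/
theorem leUpTo_map_prodMk {P : Measure Ω} [IsProbabilityMeasure P] {S S' : Ω → Y} {M : Ω → Z}
    (hS : Measurable S) (hS' : Measurable S') (hM : Measurable M) (hind : IndepFun S' M P)
    {z : Z} (hz : MeasurableSet {z}) {U V : Set Ω}
    (hV : ∀ ω, ω ∈ V ↔ M ω ≠ z) (hSS' : ∀ ω, ω ∉ U → S ω = S' ω) :
    LeUpTo (P.map fun ω => (S ω, M ω)) ((P.map S).prod (P.map M))
      (2 * (P V * P U + P (V ∩ U))) := by
  have := Measure.isProbabilityMeasure_map (μ := P) hS.aemeasurable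
  have := Measure.isProbabilityMeasure_map (μ := P) hS'.aemeasurable
  have := Measure.isProbabilityMeasure_map (μ := P) hM.aemeasurable
  have hVm : V = M ⁻¹' {z}ᶜ := by ext ω; simp [hV]
  have hVmeas : MeasurableSet V := hVm ▸ hM hz.compl
  have hmapV : P.map M {z}ᶜ = P V := by rw [Measure.map_apply hM hz.compl, hVm]
  have hmapV' : P.map M {z} = P Vᶜ := by
    rw [Measure.map_apply hM hz, hVm, Set.preimage_compl, compl_compl]
  have hprod := (indepFun_iff_map_prod_eq_prod_map_map hS'.aemeasurable hM.aemeasurable).1 hind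
  have hSle : LeUpTo (P.map S') (P.map S) (P U) := fun B hB => by
    rw [Measure.map_apply hS' hB, Measure.map_apply hS hB]
    refine (measure_mono (t := S ⁻¹' B ∪ U) fun ω hω => ?_).trans (measure_union_le _ _)
    by_cases hU : ω ∈ U
    · exact Or.inr hU
    · exact Or.inl (by simpa [hSS' ω hU] using hω)
  intro A hA
  rw [Measure.map_apply (hS.prodMk hM) hA]
  set A₁ : Set (Y × Z) := A ∩ Set.univ ×ˢ {z}ᶜ with hA₁
  set B : Set Y := (fun y => (y, z)) ⁻¹' A with hBdef
  have hA₁m : MeasurableSet A₁ := hA.inter (MeasurableSet.univ.prod hz.compl)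
  have hB : MeasurableSet B := measurable_prodMk_right hA
  have hAeq : A = A₁ ∪ B ×ˢ {z} := by
    ext ⟨y, z'⟩
    by_cases h : z' = z
    · subst h; simp [hA₁, hBdef]
    · simp [hA₁, hBdef, h]
  have hdisj : Disjoint A₁ (B ×ˢ {z}) := by
    rw [Set.disjoint_left]
    rintro ⟨y, z'⟩ h1 h2
    exact h1.2.2 h2.2
  have hpart1 : P ((fun ω => (S ω, M ω)) ⁻¹' A₁) ≤
      ((P.map S).prod (P.map M)) A₁ + (P V * P U + P (V ∩ U)) := by
    calc P ((fun ω => (S ω, M ω)) ⁻¹' A₁)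
        ≤ P ((fun ω => (S' ω, M ω)) ⁻¹' A₁) + P (V ∩ U) := by
          refine (measure_mono fun ω hω => ?_).trans (measure_union_le _ _)
          by_cases hU : ω ∈ U
          · exact Or.inr ⟨(hV ω).2 hω.2.2, hU⟩
          · left
            simpa [hSS' ω hU] using hω
      _ = ((P.map S').prod (P.map M)) A₁ + P (V ∩ U) := by
          rw [← hprod, Measure.map_apply (hS'.prodMk hM) hA₁m]
      _ ≤ ((P.map S).prod (P.map M)) A₁ + P V * P U + P (V ∩ U) := by
          gcongr
          rw [Measure.prod_apply_symm hA₁m, Measure.prod_apply_symm hA₁m]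
          calc _ ≤ ∫⁻ y, ((P.map S) ((fun x => (x, y)) ⁻¹' A₁) +
                ({z}ᶜ : Set Z).indicator (fun _ => P U) y) ∂(P.map M) := by
                refine lintegral_mono fun y => ?_
                by_cases hy : y = z
                · have : (fun x : Y => (x, y)) ⁻¹' A₁ = ∅ := by ext; simp [hA₁, hy]
                  simp [this]
                · have hy' : y ∈ ({z}ᶜ : Set Z) := hy
                  rw [Set.indicator_of_mem hy']
                  exact hSle _ (measurable_prodMk_right hA₁m)
            _ = _ := by
                rw [lintegral_add_right _ (measurable_const.indicator hz.compl),
                  lintegral_indicator hz.compl, setLIntegral_const, hmapV, mul_comm]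
      _ = _ := by rw [add_assoc]
  have hpart2 : P ((fun ω => (S ω, M ω)) ⁻¹' (B ×ˢ {z})) ≤
      ((P.map S).prod (P.map M)) (B ×ˢ {z}) + (P V * P U + P (V ∩ U)) := by
    have hpre : (fun ω => (S ω, M ω)) ⁻¹' (B ×ˢ {z}) = S ⁻¹' B ∩ Vᶜ := by
      ext ω; simp [hV]
    rw [hpre, Measure.prod_prod, Measure.map_apply hS hB, hmapV']
    refine ENNReal.le_of_add_le_add_right (measure_ne_top P (S ⁻¹' B ∩ V)) ?_
    have h1 : P (S ⁻¹' B ∩ Vᶜ) + P (S ⁻¹' B ∩ V) = P (S ⁻¹' B) := by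
      rw [← Set.sdiff_eq, add_comm, measure_inter_add_sdiff _ hVmeas]
    have h2 : P (S ⁻¹' B) = P (S ⁻¹' B) * P Vᶜ + P (S ⁻¹' B) * P V := by
      rw [← mul_add, add_comm (P Vᶜ), measure_add_measure_compl hVmeas, measure_univ, mul_one]
    have h3 : P (S' ⁻¹' B ∩ V) = P (S' ⁻¹' B) * P V := by
      rw [hVm, hind.measure_inter_preimage_eq_mul _ _ hB hz.compl]
    have h4 : P (S ⁻¹' B) * P V ≤ P (S ⁻¹' B ∩ V) + (P V * P U + P (V ∩ U)) := by
      have hSle' : P (S ⁻¹' B) ≤ P (S' ⁻¹' B) + P U := by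
        refine (measure_mono fun ω hω => ?_).trans (measure_union_le _ _)
        by_cases hU : ω ∈ U
        · exact Or.inr hU
        · exact Or.inl (by simpa [hSS' ω hU] using hω)
      have hle : P (S' ⁻¹' B ∩ V) ≤ P (S ⁻¹' B ∩ V) + P (V ∩ U) := by
        refine (measure_mono fun ω hω => ?_).trans (measure_union_le _ _)
        by_cases hU : ω ∈ U
        · exact Or.inr ⟨hω.2, hU⟩
        · exact Or.inl ⟨by simpa [hSS' ω hU] using hω.1, hω.2⟩
      calc P (S ⁻¹' B) * P V ≤ (P (S' ⁻¹' B) + P U) * P V := by gcongr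
        _ = P (S' ⁻¹' B ∩ V) + P V * P U := by rw [add_mul, h3, mul_comm (P U)]
        _ ≤ P (S ⁻¹' B ∩ V) + P (V ∩ U) + P V * P U := by gcongr
        _ = _ := by ring
    rw [h1]
    calc P (S ⁻¹' B) = P (S ⁻¹' B) * P Vᶜ + P (S ⁻¹' B) * P V := h2
      _ ≤ P (S ⁻¹' B) * P Vᶜ + (P (S ⁻¹' B ∩ V) + (P V * P U + P (V ∩ U))) := by gcongr
      _ = _ := by ring
  calc P ((fun ω => (S ω, M ω)) ⁻¹' A)
      ≤ P ((fun ω => (S ω, M ω)) ⁻¹' A₁) + P ((fun ω => (S ω, M ω)) ⁻¹' (B ×ˢ {z})) := by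
        conv_lhs => rw [hAeq, Set.preimage_union]
        exact measure_union_le _ _
    _ ≤ _ := add_le_add hpart1 hpart2
    _ = ((P.map S).prod (P.map M)) A + 2 * (P V * P U + P (V ∩ U)) := by
        conv_rhs => rw [hAeq, measure_union hdisj (hB.prod hz)]
        ring

end Decoupling

/-! ### Poisson approximation of a sum of dependent points -/

section PoissonApproximation

variable {Ω X : Type*} [MeasurableSpace Ω] [MeasurableSpace X]

open Classical in
/-- The point `f ω`, present if `ω ∈ V`. -/
noncomputable def optPoint {W : Type*} (V : Set W) (f : W → X) (ω : W) : Measure X :=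
  if ω ∈ V then Measure.dirac (f ω) else 0

theorem measurable_optPoint {V : Set Ω} (hV : MeasurableSet V) {f : Ω → X} (hf : Measurable f) :
    Measurable (optPoint V f) := by
  classical
  exact Measurable.ite hV (Measure.measurable_dirac.comp hf) measurable_const

theorem optPoint_ne_zero_iff {W : Type*} {V : Set W} {f : W → X} {ω : W} :
    ω ∈ V ↔ optPoint V f ω ≠ 0 := by
  unfold optPoint
  by_cases h : ω ∈ V
  · simp only [h, if_true, true_iff]
    exact NeZero.ne _
  · simp [h]

theorem measurableSet_singleton_zero_measure : MeasurableSet {(0 : Measure X)} := by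
  have : {(0 : Measure X)} = (fun ν : Measure X => ν Set.univ) ⁻¹' {0} := by
    ext ν; simp
  rw [this]
  exact Measure.measurable_coe .univ (measurableSet_singleton 0)

/-- The intensity of a point that is present on `V`. -/
noncomputable def pointIntensity (P : Measure Ω) (V : Set Ω) (f : Ω → X) : Measure X :=
  (P.restrict V).map f

theorem pointIntensity_univ (P : Measure Ω) (V : Set Ω) {f : Ω → X} (hf : Measurable f) :
    pointIntensity P V f Set.univ = P V := by
  rw [pointIntensity, Measure.map_apply hf .univ]; simp

instance (P : Measure Ω) [IsFiniteMeasure P] (V : Set Ω) (f : Ω → X) :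
    IsFiniteMeasure (pointIntensity P V f) := by
  unfold pointIntensity; infer_instance

theorem map_optPoint_apply {P : Measure Ω} {V : Set Ω} (hV : MeasurableSet V)
    {f : Ω → X} (hf : Measurable f) {A : Set (Measure X)} (hA : MeasurableSet A) :
    P.map (optPoint V f) A = P Vᶜ * Measure.dirac 0 A +
      (pointIntensity P V f).map Measure.dirac A := by
  classical
  rw [Measure.map_apply (measurable_optPoint hV hf) hA, pointIntensity,
    Measure.map_map Measure.measurable_dirac hf,
    Measure.map_apply (Measure.measurable_dirac.comp hf) hA,
    Measure.restrict_apply ((Measure.measurable_dirac.comp hf) hA),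
    ← measure_inter_add_sdiff (optPoint V f ⁻¹' A) hV, add_comm]
  congr 1
  · rw [Measure.dirac_apply' _ hA]
    by_cases h0 : (0 : Measure X) ∈ A
    · rw [Set.indicator_of_mem h0, Pi.one_apply, mul_one]
      congr 1
      ext ω
      by_cases hω : ω ∈ V <;> simp [optPoint, hω, h0]
    · rw [Set.indicator_of_notMem h0, mul_zero]
      convert! measure_empty (μ := P)
      ext ω
      by_cases hω : ω ∈ V <;> simp [optPoint, hω, h0]
  · congr 1
    ext ω
    by_cases hω : ω ∈ V <;> simp [optPoint, hω]

theorem leUpTo_optPoint_poissonLaw {P : Measure Ω} [IsProbabilityMeasure P] {V : Set Ω}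
    (hV : MeasurableSet V) {f : Ω → X} (hf : Measurable f) :
    LeUpTo (P.map (optPoint V f)) (poissonLaw (pointIntensity P V f)) (P V ^ 2) := by
  intro A hA
  refine le_trans ?_ (add_le_add_left (le_poissonLaw_apply (pointIntensity P V f) A) _)
  rw [map_optPoint_apply hV hf hA]
  set lam := pointIntensity P V f
  have hp : lam.real Set.univ = P.real V := by
    rw [measureReal_def, pointIntensity_univ P V hf, measureReal_def]
  have hb : lam.map Measure.dirac A ≤ P V := by
    rw [← pointIntensity_univ P V hf, Measure.map_apply Measure.measurable_dirac hA]
    exact measure_mono (Set.subset_univ _)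
  have hb' := ENNReal.toReal_mono (by finiteness) hb
  have hbf : lam.map Measure.dirac A ≠ ∞ := ne_top_of_le_ne_top (by finiteness) hb
  rw [hp, ← ENNReal.toReal_le_toReal (by finiteness) (by finiteness),
    ENNReal.toReal_add (by finiteness) hbf, ENNReal.toReal_add (by finiteness) (by finiteness),
    ENNReal.toReal_mul, ENNReal.toReal_mul, ENNReal.toReal_add (by finiteness) hbf,
    ENNReal.toReal_ofReal (Real.exp_pos _).le, ENNReal.toReal_pow]
  have hc : (P Vᶜ).toReal = 1 - P.real V := probReal_compl_eq_one_sub hV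
  rw [hc]
  have h0 : 0 ≤ (Measure.dirac (0 : Measure X) A).toReal := ENNReal.toReal_nonneg
  have h0' : 0 ≤ (lam.map Measure.dirac A).toReal := ENNReal.toReal_nonneg
  have he := Real.add_one_le_exp (-(P.real V))
  change _ ≤ P.real V at hb'
  change _ ≤ _ + P.real V ^ 2
  have hP0 : 0 ≤ P.real V := measureReal_nonneg
  set p := P.real V
  set a := (Measure.dirac (0 : Measure X) A).toReal
  set b := (lam.map Measure.dirac A).toReal
  nlinarith [mul_nonneg h0 (sub_nonneg.2 he), mul_nonneg h0' (sub_nonneg.2 he),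
    mul_nonneg hP0 (sub_nonneg.2 hb')]

/-- Poisson approximation for a sum of points with local dependence: the point `i` is independent
of the points that are not related to it by `R`. -/
theorem exists_hasPoissonChar_leUpTo {ι : Type*}
    (P : Measure Ω) [IsProbabilityMeasure P] (V : ι → Set Ω) (hV : ∀ i, MeasurableSet (V i))
    (f : ι → Ω → X) (hf : ∀ i, Measurable (f i)) (R : ι → ι → Prop) [DecidableRel R]
    [DecidableEq ι]
    (hind : ∀ i (T : Finset ι), (∀ j ∈ T, ¬ R i j) →
      IndepFun (fun ω => ∑ j ∈ T, optPoint (V j) (f j) ω) (optPoint (V i) (f i)) P)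
    (s : Finset ι) :
    ∃ Q, HasPoissonChar (∑ i ∈ s, pointIntensity P (V i) (f i)) Q ∧
      LeUpTo (P.map fun ω => ∑ i ∈ s, optPoint (V i) (f i) ω) Q
        (∑ i ∈ s, (P (V i) ^ 2 + 2 * ∑ j ∈ s with j ≠ i ∧ R i j,
          (P (V i) * P (V j) + P (V i ∩ V j)))) := by
  induction s using Finset.induction_on with
  | empty =>
    refine ⟨Measure.dirac 0, by simpa using hasPoissonChar_zero, fun A hA => ?_⟩
    simp
  | insert i s his ih =>
    obtain ⟨Q, hQ, hle⟩ := ih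
    have := hQ.isProbabilityMeasure
    have := isProbabilityMeasure_poissonLaw (pointIntensity P (V i) (f i))
    have hMm : ∀ j, Measurable (optPoint (V j) (f j)) := fun j => measurable_optPoint (hV j) (hf j)
    have hSm : ∀ T : Finset ι, Measurable fun ω => ∑ j ∈ T, optPoint (V j) (f j) ω :=
      fun T => Finset.measurable_sum _ fun j _ => hMm j
    have := Measure.isProbabilityMeasure_map (μ := P) (hSm s).aemeasurable
    have := Measure.isProbabilityMeasure_map (μ := P) (hMm i).aemeasurable
    refine ⟨superpose Q (poissonLaw (pointIntensity P (V i) (f i))), ?_, ?_⟩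
    · rw [Finset.sum_insert his, add_comm]
      have : IsFiniteMeasure (∑ i ∈ s, pointIntensity P (V i) (f i)) := inferInstance
      exact hQ.superpose (hasPoissonChar_poissonLaw _)
    let U : Set Ω := ⋃ j ∈ s.filter (R i), V j
    have h1 := leUpTo_map_prodMk (hSm s) (hSm (s.filter fun j => ¬ R i j)) (hMm i)
      (hind i _ fun j hj => (Finset.mem_filter.1 hj).2) measurableSet_singleton_zero_measure
      (U := U) (fun ω => optPoint_ne_zero_iff (f := f i)) fun ω hω => by
        refine (Finset.sum_subset (Finset.filter_subset _ _) fun j hj hj' => ?_).symm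
        by_contra h0
        have hR : R i j := by
          by_contra hR
          exact hj' (Finset.mem_filter.2 ⟨hj, hR⟩)
        exact hω (Set.mem_biUnion (Finset.mem_coe.2 (Finset.mem_filter.2 ⟨hj, hR⟩))
          (optPoint_ne_zero_iff.2 h0))
    have h2 := hle.prod (leUpTo_optPoint_poissonLaw (P := P) (hV i) (hf i))
    have h3 := (h1.trans h2).map measurable_add_measure
    rw [Measure.map_map measurable_add_measure ((hSm s).prodMk (hMm i))] at h3
    intro A hA
    have h4 := h3 A hA
    have hfun : (fun ω => ∑ j ∈ insert i s, optPoint (V j) (f j) ω) =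
        ((fun p : Measure X × Measure X => p.1 + p.2) ∘ fun ω =>
          (∑ j ∈ s, optPoint (V j) (f j) ω, optPoint (V i) (f i) ω)) := by
      ext1 ω
      simp [Finset.sum_insert his, add_comm]
    rw [hfun]
    refine h4.trans ?_
    change superpose _ _ A + _ ≤ _
    refine add_le_add_right ?_ _
    rw [Finset.sum_insert his, add_comm (P (V i) ^ 2)]
    have hU : P (V i) * P U + P (V i ∩ U) ≤
        ∑ j ∈ insert i s with j ≠ i ∧ R i j, (P (V i) * P (V j) + P (V i ∩ V j)) := by
      have hfilter : s.filter (R i) = (insert i s).filter fun j => j ≠ i ∧ R i j := by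
        ext j
        simp only [Finset.mem_filter, Finset.mem_insert]
        constructor
        · rintro ⟨hj, hR⟩
          exact ⟨Or.inr hj, fun h => his (h ▸ hj), hR⟩
        · rintro ⟨hj, hne, hR⟩
          exact ⟨hj.resolve_left hne, hR⟩
      rw [← hfilter, Finset.sum_add_distrib, ← Finset.mul_sum]
      gcongr
      · exact measure_biUnion_finset_le _ _
      · rw [Set.inter_iUnion₂]
        exact measure_biUnion_finset_le _ _
    have hmono : ∑ k ∈ s, (P (V k) ^ 2 + 2 * ∑ j ∈ s with j ≠ k ∧ R k j,
          (P (V k) * P (V j) + P (V k ∩ V j))) ≤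
        ∑ k ∈ s, (P (V k) ^ 2 + 2 * ∑ j ∈ insert i s with j ≠ k ∧ R k j,
          (P (V k) * P (V j) + P (V k ∩ V j))) := by
      gcongr with k hk
      exact Finset.subset_insert _ _
    refine (add_le_add (mul_le_mul_right hU 2) (add_le_add hmono le_rfl)).trans (le_of_eq ?_)
    ring

end PoissonApproximation

/-! ### Coupling -/

section Coupling

variable {W Y : Type*} [MeasurableSpace W] [MeasurableSpace Y]

theorem LeUpTo.one_le_inf {μ ν : Measure Y} [IsProbabilityMeasure μ] [IsProbabilityMeasure ν]
    {δ : ℝ≥0∞} (h : LeUpTo μ ν δ) : 1 ≤ (μ ⊓ ν) Set.univ + δ := by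
  rw [Measure.inf_apply .univ, ENNReal.sInf_add]
  refine le_iInf₂ fun x hx => ?_
  obtain ⟨t, rfl⟩ := hx
  simp only [Set.inter_univ]
  have h1 : ν t ≤ μ t + δ :=
    (measure_mono (subset_toMeasurable μ t)).trans
      ((h.symm _ (measurableSet_toMeasurable μ t)).trans_eq (by rw [measure_toMeasurable]))
  calc (1 : ℝ≥0∞) = ν Set.univ := measure_univ.symm
    _ = ν (t ∪ tᶜ) := by rw [Set.union_compl_self]
    _ ≤ ν t + ν tᶜ := measure_union_le _ _
    _ ≤ μ t + δ + ν tᶜ := by gcongr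
    _ = _ := by ring

/-- A function `F` of a random variable of law `μ` can be coupled with a variable of law `Q` so
that they agree up to the distance of their laws. -/
theorem LeUpTo.exists_coupling {μ : Measure W} [IsProbabilityMeasure μ] {Q : Measure Y}
    [IsProbabilityMeasure Q] {F : W → Y} (hF : Measurable F) {δ : ℝ≥0∞}
    (h : LeUpTo (μ.map F) Q δ) :
    ∃ P : Measure (Bool × W × Y), IsProbabilityMeasure P ∧ P.map (fun ω => ω.2.1) = μ ∧
      P.map (fun ω => if ω.1 then F ω.2.1 else ω.2.2) = Q ∧ P {ω | ω.1 = false} ≤ δ := by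
  have := Measure.isProbabilityMeasure_map (μ := μ) hF.aemeasurable
  obtain ⟨y₀⟩ := nonempty_of_isProbabilityMeasure Q
  set κ := μ.map F ⊓ Q with hκ
  have hκ1 : κ ≤ μ.map F := inf_le_left
  have hκ2 : κ ≤ Q := inf_le_right
  have : IsFiniteMeasure κ := isFiniteMeasure_of_le Q hκ2
  have hmass := h.one_le_inf
  set g : Y → ℝ≥0∞ := fun y => min 1 (κ.rnDeriv (μ.map F) y) with hg
  have hgm : Measurable g := measurable_const.min (Measure.measurable_rnDeriv _ _)
  have hgF : Measurable (g ∘ F) := hgm.comp hF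
  have hκg : (μ.map F).withDensity g = κ := by
    rw [← Measure.withDensity_rnDeriv_eq κ (μ.map F) (Measure.absolutelyContinuous_of_le hκ1)]
    refine withDensity_congr_ae ?_
    filter_upwards [Measure.rnDeriv_le_one_of_le hκ1] with y hy
    exact min_eq_right hy
  set μ₁ := μ.withDensity (g ∘ F) with hμ₁
  set μ₂ := μ.withDensity (fun w => 1 - g (F w)) with hμ₂
  have hadd : μ₁ + μ₂ = μ := by
    rw [hμ₁, hμ₂, ← withDensity_add_left hgF]
    have : (g ∘ F + fun w => 1 - g (F w)) = 1 := by
      ext w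
      simp only [Pi.add_apply, Function.comp_apply, Pi.one_apply]
      exact add_tsub_cancel_of_le (min_le_left _ _)
    rw [this, withDensity_one]
  have hmap : μ₁.map F = κ := by
    rw [← hκg]
    ext A hA
    rw [Measure.map_apply hF hA, hμ₁, withDensity_apply _ (hF hA), withDensity_apply _ hA,
      setLIntegral_map hA hgm hF]
    rfl
  have : IsFiniteMeasure μ₁ := isFiniteMeasure_of_le μ (hadd ▸ Measure.le_add_right le_rfl)
  have : IsFiniteMeasure μ₂ := isFiniteMeasure_of_le μ (hadd ▸ Measure.le_add_left le_rfl)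
  set ρ := Q - κ with hρ
  have hQ : ρ + κ = Q := Measure.sub_add_cancel_of_le hκ2
  have : IsFiniteMeasure ρ := isFiniteMeasure_of_le Q (hQ ▸ Measure.le_add_right le_rfl)
  have hμ₁κ : μ₁ Set.univ = κ Set.univ := by rw [← hmap, Measure.map_apply hF .univ, Set.preimage_univ]
  have h1 : μ₁ Set.univ + μ₂ Set.univ = 1 := by rw [← Measure.add_apply, hadd, measure_univ]
  have h2 : ρ Set.univ + κ Set.univ = 1 := by rw [← Measure.add_apply, hQ, measure_univ]
  set m := ρ Set.univ with hm
  have hmfin : m ≠ ∞ := measure_ne_top _ _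
  have hμ₂m : μ₂ Set.univ = m := by
    rw [hμ₁κ, add_comm, ← h2] at h1
    exact (ENNReal.add_left_inj (measure_ne_top κ _)).1 h1
  have hmδ : m ≤ δ := by
    refine ENNReal.le_of_add_le_add_right (measure_ne_top κ Set.univ) ?_
    rw [h2, add_comm]; exact hmass
  have hcancelY : m⁻¹ • m • ρ = ρ := by
    by_cases h0 : m = 0
    · have : ρ = 0 := Measure.measure_univ_eq_zero.1 h0
      simp [this]
    · rw [smul_smul, ENNReal.inv_mul_cancel h0 hmfin, one_smul]
  have hcancelW : m⁻¹ • m • μ₂ = μ₂ := by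
    by_cases h0 : m = 0
    · have : μ₂ = 0 := Measure.measure_univ_eq_zero.1 (hμ₂m.trans h0)
      simp [this]
    · rw [smul_smul, ENNReal.inv_mul_cancel h0 hmfin, one_smul]
  let P : Measure (Bool × W × Y) := μ₁.map (fun w => (true, w, y₀)) +
    m⁻¹ • (μ₂.prod ρ).map (fun p => (false, p.1, p.2))
  have hm1 : Measurable fun w : W => (true, w, y₀) := by fun_prop
  have hm2 : Measurable fun p : W × Y => (false, p.1, p.2) := by fun_prop
  have hfst : Measurable fun ω : Bool × W × Y => ω.2.1 := by fun_prop
  have hb : MeasurableSet {ω : Bool × W × Y | ω.1 = false} :=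
    measurable_fst (measurableSet_singleton false)
  have hb' : MeasurableSet {ω : Bool × W × Y | ω.1 = true} :=
    measurable_fst (measurableSet_singleton true)
  have hη : Measurable fun ω : Bool × W × Y => if ω.1 then F ω.2.1 else ω.2.2 :=
    Measurable.ite hb' (hF.comp hfst) (by fun_prop)
  have hPfst : P.map (fun ω => ω.2.1) = μ := by
    rw [Measure.map_add _ _ hfst, Measure.map_smul, Measure.map_map hfst hm1,
      Measure.map_map hfst hm2]
    have e1 : (fun ω : Bool × W × Y => ω.2.1) ∘ (fun w => (true, w, y₀)) = id := rfl
    have e2 : (fun ω : Bool × W × Y => ω.2.1) ∘ (fun p : W × Y => (false, p.1, p.2)) =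
      Prod.fst := rfl
    rw [e1, e2, Measure.map_id, Measure.map_fst_prod, ← hm, hcancelW, hadd]
  refine ⟨P, ?_, hPfst, ?_, ?_⟩
  · constructor
    rw [← Set.preimage_univ (f := fun ω : Bool × W × Y => ω.2.1), ← Measure.map_apply hfst .univ,
      hPfst, measure_univ]
  · rw [Measure.map_add _ _ hη, Measure.map_smul, Measure.map_map hη hm1, Measure.map_map hη hm2]
    have e1 : (fun ω : Bool × W × Y => if ω.1 then F ω.2.1 else ω.2.2) ∘
      (fun w => (true, w, y₀)) = F := by ext1 w; simp
    have e2 : (fun ω : Bool × W × Y => if ω.1 then F ω.2.1 else ω.2.2) ∘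
      (fun p : W × Y => (false, p.1, p.2)) = Prod.snd := by ext1 p; simp
    rw [e1, e2, hmap, Measure.map_snd_prod, hμ₂m, hcancelY, add_comm, hQ]
  · have e1 : (fun w => (true, w, y₀)) ⁻¹' {ω : Bool × W × Y | ω.1 = false} = ∅ := by
      ext; simp
    have e2 : (fun p : W × Y => (false, p.1, p.2)) ⁻¹' {ω : Bool × W × Y | ω.1 = false} =
      Set.univ := by ext; simp
    rw [Measure.add_apply, Measure.smul_apply, Measure.map_apply hm1 hb, Measure.map_apply hm2 hb,
      e1, e2, measure_empty, zero_add, ← Set.univ_prod_univ, Measure.prod_prod, hμ₂m, ← hm,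
      smul_eq_mul]
    by_cases h0 : m = 0
    · simp [h0]
    · rwa [← mul_assoc, ENNReal.inv_mul_cancel h0 hmfin, one_mul]

end Coupling

/-! ### Exponential weights -/

section Weights

variable {E : Type*} [Fintype E]

instance : IsProbabilityMeasure (expMeasure 1) := isProbabilityMeasure_expMeasure one_pos

instance : IsProbabilityMeasure (weightLaw E) := by unfold weightLaw; infer_instance

theorem measurable_exponentialPDF (r : ℝ) : Measurable (exponentialPDF r) :=
  (measurable_exponentialPDFReal r).ennreal_ofReal

theorem expMeasure_eq_withDensity (r : ℝ) :
    expMeasure r = volume.withDensity (exponentialPDF r) := rfl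

theorem lintegral_exp_neg_mul_expMeasure_le {θ : ℝ} (hθ : 0 < θ) :
    ∫⁻ x, ENNReal.ofReal (Real.exp (-(θ * x))) ∂expMeasure 1 ≤ ENNReal.ofReal θ⁻¹ := by
  have hm := measurable_exponentialPDF
  rw [expMeasure_eq_withDensity, lintegral_withDensity_eq_lintegral_mul _ (hm 1) (by fun_prop)]
  calc _ ≤ ∫⁻ x, ENNReal.ofReal θ⁻¹ * exponentialPDF θ x := by
        refine lintegral_mono fun x => ?_
        rcases lt_or_ge x 0 with hx | hx
        · simp [exponentialPDF_of_neg hx]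
        · rw [Pi.mul_apply, exponentialPDF_of_nonneg hx, exponentialPDF_of_nonneg hx,
            ← ENNReal.ofReal_mul (by positivity), ← ENNReal.ofReal_mul (by positivity)]
          refine ENNReal.ofReal_le_ofReal ?_
          have h1 : Real.exp (-(1 * x)) ≤ 1 := Real.exp_le_one_iff.2 (by linarith)
          have h2 := (Real.exp_pos (-(θ * x))).le
          rw [inv_mul_cancel_left₀ hθ.ne']
          nlinarith
    _ = ENNReal.ofReal θ⁻¹ := by
        rw [lintegral_const_mul _ (hm θ), lintegral_exponentialPDF_eq_one hθ, mul_one]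

theorem ae_weightLaw_nonneg : ∀ᵐ w ∂weightLaw E, ∀ e, 0 ≤ w e := by
  rw [ae_all_iff]
  intro e
  refine (Measure.quasiMeasurePreserving_eval (μ := fun _ : E => expMeasure 1) e).ae
    (p := fun x : ℝ => 0 ≤ x) ?_
  rw [expMeasure_eq_withDensity, ae_withDensity_iff (measurable_exponentialPDF 1)]
  filter_upwards with x hx
  by_contra h
  exact hx (exponentialPDF_of_neg (not_le.1 h))

theorem lintegral_exp_neg_sum_le (T : Finset E) {θ : ℝ} (hθ : 0 < θ) :
    ∫⁻ w, ENNReal.ofReal (Real.exp (-(θ * ∑ e ∈ T, w e))) ∂weightLaw E ≤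
      ENNReal.ofReal θ⁻¹ ^ T.card := by
  have hm : Measurable fun x : ℝ => ENNReal.ofReal (Real.exp (-(θ * x))) := by fun_prop
  have h1 : ∀ w : E → ℝ, ENNReal.ofReal (Real.exp (-(θ * ∑ e ∈ T, w e))) =
      ∏ e ∈ T, ENNReal.ofReal (Real.exp (-(θ * w e))) := fun w => by
    rw [← ENNReal.ofReal_prod_of_nonneg (fun _ _ => (Real.exp_pos _).le), ← Real.exp_sum,
      Finset.sum_neg_distrib, Finset.mul_sum]
  simp only [h1]
  have hind : iIndepFun (fun (e : E) (w : E → ℝ) => ENNReal.ofReal (Real.exp (-(θ * w e))))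
      (weightLaw E) :=
    iIndepFun_pi (X := fun _ x => ENNReal.ofReal (Real.exp (-(θ * x)))) fun _ => hm.aemeasurable
  rw [lintegral_prod_eq_prod_lintegral_of_indepFun T _ hind
    fun e => hm.comp (measurable_pi_apply e)]
  refine Finset.prod_le_pow_card _ _ _ fun e _ => ?_
  refine le_trans (le_of_eq ?_) (lintegral_exp_neg_mul_expMeasure_le hθ)
  exact (measurePreserving_eval (fun _ : E => expMeasure 1) e).lintegral_comp hm

theorem IsLight.sum_le {E : Type*} {n : ℕ} {w : E → ℝ} {c : ℝ} {C : Finset E} (hC : C.Nonempty)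
    (hn : 0 < n) (h : IsLight n w c C) : n * ∑ e ∈ C, w e ≤ c * C.card := by
  have h0 : (0 : ℝ) < C.card := by exact_mod_cast hC.card_pos
  have h1 : (0 : ℝ) < n := by exact_mod_cast hn
  rw [IsLight, meanWeight, div_le_div_iff₀ h0 h1] at h
  linarith

theorem measurableSet_isLight {E : Type*} (n : ℕ) (c : ℝ) (C : Finset E) :
    MeasurableSet {w : E → ℝ | IsLight n w c C} :=
  measurableSet_le (measurable_meanWeight C) measurable_const

/-- Two cycles are both light with probability at most `e^{c(k+l)}` times `n⁻¹` to the number of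
edges in their union. -/
theorem weightLaw_isLight_inter_le [DecidableEq E] {n : ℕ} (hn : 0 < n) (c : ℝ) {C D : Finset E}
    (hC : C.Nonempty) (hD : D.Nonempty) :
    weightLaw E ({w | IsLight n w c C} ∩ {w | IsLight n w c D}) ≤
      ENNReal.ofReal (Real.exp (c * (C.card + D.card))) *
        ENNReal.ofReal (n : ℝ)⁻¹ ^ (C ∪ D).card := by
  have hn' : (0 : ℝ) < n := by exact_mod_cast hn
  set a := ENNReal.ofReal (Real.exp (-(c * (C.card + D.card)))) with ha
  have ha0 : a ≠ 0 := by simp [ha, Real.exp_pos]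
  have hinv : a⁻¹ = ENNReal.ofReal (Real.exp (c * (C.card + D.card))) := by
    rw [ha, ← ENNReal.ofReal_inv_of_pos (Real.exp_pos _), ← Real.exp_neg, neg_neg]
  have hmarkov := mul_meas_ge_le_lintegral (μ := weightLaw E)
    (f := fun w => ENNReal.ofReal (Real.exp (-(n * ∑ e ∈ C ∪ D, w e)))) (by fun_prop) a
  have hsub : weightLaw E ({w | IsLight n w c C} ∩ {w | IsLight n w c D}) ≤
      weightLaw E {w | a ≤ ENNReal.ofReal (Real.exp (-(n * ∑ e ∈ C ∪ D, w e)))} := by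
    refine measure_mono_ae ?_
    filter_upwards [ae_weightLaw_nonneg (E := E)] with w hw hlight
    refine ENNReal.ofReal_le_ofReal (Real.exp_le_exp.2 (neg_le_neg ?_))
    have h1 := IsLight.sum_le hC hn hlight.1
    have h2 := IsLight.sum_le hD hn hlight.2
    have h3 : ∑ e ∈ C ∪ D, w e ≤ ∑ e ∈ C, w e + ∑ e ∈ D, w e := by
      rw [← Finset.sum_union_inter]
      exact le_add_of_nonneg_right (Finset.sum_nonneg fun e _ => hw e)
    nlinarith
  refine hsub.trans ?_
  rw [← hinv, mul_comm, ← ENNReal.div_eq_inv_mul.trans (mul_comm _ _)]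
  rw [ENNReal.le_div_iff_mul_le (Or.inl ha0) (Or.inl ENNReal.ofReal_ne_top), mul_comm]
  exact hmarkov.trans (lintegral_exp_neg_sum_le _ hn')

end Weights

/-! ### Combinatorics of cycles -/

section Cycles

theorem ZMod.forall_of_add_one {k : ℕ} [NeZero k] {p : ZMod k → Prop} (j : ZMod k) (hj : p j)
    (h : ∀ i, p i → p (i + 1)) (i : ZMod k) : p i := by
  have key : ∀ m : ℕ, p (j + m) := fun m => by
    induction m with
    | zero => simpa using hj
    | succ m ih => simpa [add_assoc] using h _ ih
  simpa using key (i - j).val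

theorem ZMod.add_one_ne_sub_one {k : ℕ} (hk : 3 ≤ k) (i : ZMod k) : i + 1 ≠ i - 1 := by
  intro h
  have h2 : ((2 : ℕ) : ZMod k) = 0 := by
    push_cast
    linear_combination h
  rw [ZMod.natCast_eq_zero_iff] at h2
  exact absurd (Nat.le_of_dvd two_pos h2) (by omega)

variable {V E T : Type*}

/-- The `i`-th edge of the closed walk `v`, where `ed x y` is the edge between `x` and `y`. -/
def walkEdge (ed : V → V → T) {k : ℕ} (v : ZMod k → V) (i : ZMod k) : T :=
  ed (v i) (v (i + 1))

/-- The cycles of length at least `k₀`, as edge sets, where `ed x y` is the edge between `x` and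
`y`. -/
def cyclesOf (val : E → T) (ed : V → V → T) (k₀ : ℕ) : Set (Finset E) :=
  {C | ∃ k : ℕ, k₀ ≤ k ∧ ∃ v : ZMod k → V, Function.Injective v ∧
    val '' (C : Set E) = Set.range (walkEdge ed v)}

/-- The properties of the complete graphs that are used for counting cycles. -/
structure IsEdgeMap (val : E → T) (ed : V → V → T) (k₀ : ℕ) : Prop where
  two_le : 2 ≤ k₀
  val_injective : Function.Injective val
  ends_left : ∀ {x y x' y'}, ed x y = ed x' y' → x = x' ∨ x = y'
  ends_right : ∀ {x y x' y'}, ed x y = ed x' y' → y = x' ∨ y = y'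
  walkEdge_injective : ∀ {k : ℕ}, k₀ ≤ k → ∀ {v : ZMod k → V}, Function.Injective v →
    Function.Injective (walkEdge ed v)
  range_subset : ∀ {k l : ℕ}, k₀ ≤ k → k₀ ≤ l → ∀ {u : ZMod k → V} {v : ZMod l → V},
    Function.Injective u → Function.Injective v →
    Set.range (walkEdge ed v) ⊆ Set.range (walkEdge ed u) →
    Set.range (walkEdge ed u) ⊆ Set.range (walkEdge ed v)

theorem isEdgeMap_dir : IsEdgeMap (Subtype.val : DirEdge V → V × V) Prod.mk 2 where
  two_le := le_rfl
  val_injective := Subtype.val_injective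
  ends_left h := Or.inl (Prod.mk.inj h).1
  ends_right h := Or.inr (Prod.mk.inj h).2
  walkEdge_injective _ v hv i j h := hv (Prod.mk.inj h).1
  range_subset := by
    intro k l hk hl u v hu hv h
    have : NeZero k := ⟨by omega⟩
    have hstep : ∀ (a : ZMod k) (i : ZMod l), v i = u a → v (i + 1) = u (a + 1) := by
      intro a i hia
      obtain ⟨b, hb⟩ := h ⟨i, rfl⟩
      obtain ⟨h1, h2⟩ := Prod.mk.inj hb
      have : b = a := hu (h1.trans hia)
      rw [← h2, this]
    obtain ⟨a₀, ha₀⟩ := h ⟨0, rfl⟩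
    have hall : ∀ a, ∃ i, v i = u a :=
      ZMod.forall_of_add_one a₀ ⟨0, (Prod.mk.inj ha₀).1.symm⟩ fun a ⟨i, hi⟩ => ⟨i + 1, hstep a i hi⟩
    rintro _ ⟨a, rfl⟩
    obtain ⟨i, hi⟩ := hall a
    exact ⟨i, Prod.ext hi (hstep a i hi)⟩

theorem isEdgeMap_undir : IsEdgeMap (Subtype.val : UndirEdge V → Sym2 V) (fun x y => s(x, y)) 3 where
  two_le := by norm_num
  val_injective := Subtype.val_injective
  ends_left h := by
    rcases Sym2.eq_iff.1 h with h | h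
    exacts [Or.inl h.1, Or.inr h.1]
  ends_right h := by
    rcases Sym2.eq_iff.1 h with h | h
    exacts [Or.inr h.2, Or.inl h.2]
  walkEdge_injective := by
    intro k hk v hv i j h
    rcases Sym2.eq_iff.1 h with h | h
    · exact hv h.1
    · have h1 := hv h.1
      have h2 := hv h.2
      refine absurd ?_ (ZMod.add_one_ne_sub_one hk j)
      rw [← h1, eq_sub_iff_add_eq, h2]
  range_subset := by
    intro k l hk hl u v hu hv h
    have : NeZero k := ⟨by omega⟩
    have hnext : ∀ (a : ZMod k) (i : ZMod l), v i = u a →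
        v (i + 1) = u (a + 1) ∨ v (i + 1) = u (a - 1) := by
      intro a i hia
      obtain ⟨b, hb⟩ := h ⟨i, rfl⟩
      rcases Sym2.eq_iff.1 hb with ⟨h1, h2⟩ | ⟨h1, h2⟩
      · left
        rw [← h2, hu (h1.trans hia)]
      · right
        rw [← h1, ← hu (h2.trans hia), add_sub_cancel_right]
    have hprev : ∀ (a : ZMod k) (i : ZMod l), v i = u a →
        v (i - 1) = u (a + 1) ∨ v (i - 1) = u (a - 1) := by
      intro a i hia
      obtain ⟨b, hb⟩ := h ⟨i - 1, rfl⟩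
      simp only [walkEdge, sub_add_cancel] at hb
      rcases Sym2.eq_iff.1 hb with ⟨h1, h2⟩ | ⟨h1, h2⟩
      · right
        rw [← h1, ← hu (h2.trans hia), add_sub_cancel_right]
      · left
        rw [← h2, hu (h1.trans hia)]
    have hstep : ∀ (a : ZMod k) (i : ZMod l), v i = u a →
        v (i + 1) = u (a + 1) ∨ v (i - 1) = u (a + 1) := by
      intro a i hia
      rcases hnext a i hia with h1 | h1
      · exact Or.inl h1
      rcases hprev a i hia with h2 | h2
      · exact Or.inr h2
      exact absurd (hv (h1.trans h2.symm)) (ZMod.add_one_ne_sub_one hl i)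
    obtain ⟨a₀, ha₀⟩ := h ⟨0, rfl⟩
    have hex : ∃ a i, v i = u a := by
      rcases Sym2.eq_iff.1 ha₀ with ⟨h1, -⟩ | ⟨h1, -⟩
      exacts [⟨_, _, h1.symm⟩, ⟨_, _, h1.symm⟩]
    obtain ⟨a₁, i₁, h₁⟩ := hex
    have hall : ∀ a, ∃ i, v i = u a :=
      ZMod.forall_of_add_one a₁ ⟨i₁, h₁⟩ fun a ⟨i, hi⟩ =>
        (hstep a i hi).elim (fun h => ⟨_, h⟩) fun h => ⟨_, h⟩
    rintro _ ⟨a, rfl⟩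
    obtain ⟨i, hi⟩ := hall a
    rcases hstep a i hi with h1 | h1
    · exact ⟨i, by simp only [walkEdge, hi, h1]⟩
    · refine ⟨i - 1, ?_⟩
      simp only [walkEdge, sub_add_cancel, hi, h1]
      exact Sym2.eq_swap

open Classical in
theorem sum_filter_card_le {E : Type*} [Fintype E] (𝒞 : Set (Finset E)) (L : ℕ) (F : Finset E → ℝ≥0∞) :
    ∑ C : Finset E with C ∈ 𝒞 ∧ C.card ≤ L, F C =
      ∑ k ∈ Finset.range (L + 1), ∑ C : Finset E with C ∈ 𝒞 ∧ C.card = k, F C := by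
  rw [← Finset.sum_fiberwise_of_maps_to (t := Finset.range (L + 1)) (g := Finset.card)]
  · refine Finset.sum_congr rfl fun k hk => Finset.sum_congr ?_ fun _ _ => rfl
    ext C
    have := Finset.mem_range.1 hk
    simp only [Finset.mem_filter, Finset.mem_univ, true_and]
    constructor
    · rintro ⟨⟨h1, -⟩, h2⟩
      exact ⟨h1, h2⟩
    · rintro ⟨h1, h2⟩
      exact ⟨⟨h1, by omega⟩, h2⟩
  · intro C hC
    have := (Finset.mem_filter.1 hC).2.2
    exact Finset.mem_range.2 (by omega)

section Counting

variable {val : E → T} {ed : V → V → T} {k₀ : ℕ}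

theorem IsEdgeMap.card_eq (h : IsEdgeMap val ed k₀) {k : ℕ} (hk : k₀ ≤ k) {v : ZMod k → V}
    (hv : Function.Injective v) {C : Finset E}
    (hC : val '' (C : Set E) = Set.range (walkEdge ed v)) : C.card = k := by
  rw [← Set.ncard_coe_finset, ← Set.ncard_image_of_injective _ h.val_injective, hC,
    ← Set.image_univ, Set.ncard_image_of_injective _ (h.walkEdge_injective hk hv), Set.ncard_univ,
    Nat.card_zmod]

theorem IsEdgeMap.nonempty (h : IsEdgeMap val ed k₀) {C : Finset E}
    (hC : C ∈ cyclesOf val ed k₀) : C.Nonempty := by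
  obtain ⟨k, hk, v, hv, hC⟩ := hC
  rw [← Finset.card_pos, h.card_eq hk hv hC]
  have := h.two_le
  omega

variable [Fintype V]

open Classical in
/-- The vertices of a set of edges. -/
noncomputable def vertsOf (val : E → T) (ed : V → V → T) (C : Finset E) : Finset V :=
  {x | ∃ e ∈ C, ∃ y, val e = ed x y ∨ val e = ed y x}

theorem IsEdgeMap.mem_vertsOf (h : IsEdgeMap val ed k₀) {k : ℕ} {v : ZMod k → V} {C : Finset E}
    (hC : val '' (C : Set E) = Set.range (walkEdge ed v)) {x : V} :
    x ∈ vertsOf val ed C ↔ ∃ i, v i = x := by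
  simp only [vertsOf, Finset.mem_filter, Finset.mem_univ, true_and]
  constructor
  · rintro ⟨e, he, y, hy⟩
    have : val e ∈ Set.range (walkEdge ed v) := hC ▸ ⟨e, he, rfl⟩
    obtain ⟨i, hi⟩ := this
    rcases hy with hy | hy
    · rcases h.ends_left (hy.symm.trans hi.symm) with h1 | h1
      exacts [⟨_, h1.symm⟩, ⟨_, h1.symm⟩]
    · rcases h.ends_right (hy.symm.trans hi.symm) with h1 | h1
      exacts [⟨_, h1.symm⟩, ⟨_, h1.symm⟩]
  · rintro ⟨i, rfl⟩
    have : walkEdge ed v i ∈ val '' (C : Set E) := hC ▸ ⟨i, rfl⟩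
    obtain ⟨e, he, hei⟩ := this
    exact ⟨e, he, _, Or.inl hei⟩

theorem IsEdgeMap.card_verts (h : IsEdgeMap val ed k₀) {C : Finset E}
    (hC : C ∈ cyclesOf val ed k₀) : (vertsOf val ed C).card = C.card := by
  classical
  obtain ⟨k, hk, v, hv, hC⟩ := hC
  have : NeZero k := ⟨by have := h.two_le; omega⟩
  have himg : vertsOf val ed C = Finset.univ.image v := by
    ext x
    simp [h.mem_vertsOf hC]
  rw [himg, Finset.card_image_of_injective _ hv, h.card_eq hk hv hC, Finset.card_univ, ZMod.card]

variable [DecidableEq V]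

/-- Of the edges of a cycle `D` that meets the cycle `C` in an edge, more lie outside of `C` than
there are vertices of `D` outside of `C`. -/
theorem IsEdgeMap.card_verts_sdiff_lt [DecidableEq E] (h : IsEdgeMap val ed k₀) {C D : Finset E}
    (hC : C ∈ cyclesOf val ed k₀) (hD : D ∈ cyclesOf val ed k₀) (hne : D ≠ C)
    (hCD : (C ∩ D).Nonempty) :
    (vertsOf val ed D \ vertsOf val ed C).card + 1 ≤ (D \ C).card := by
  classical
  obtain ⟨k, hk, u, hu, hC⟩ := hC
  obtain ⟨l, hl, v, hv, hD⟩ := hD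
  have h2 := h.two_le
  have : NeZero l := ⟨by omega⟩
  have hex : ∀ i, ∃ e ∈ D, val e = walkEdge ed v i := fun i => by
    have : walkEdge ed v i ∈ val '' (D : Set E) := hD ▸ ⟨i, rfl⟩
    exact this
  choose e heD hev using hex
  have heinj : Function.Injective e := fun i j hij =>
    h.walkEdge_injective hl hv (by rw [← hev, ← hev, hij])
  have heleft : ∀ i, e i ∈ C → v i ∈ vertsOf val ed C := fun i hi => by
    simp only [vertsOf, Finset.mem_filter, Finset.mem_univ, true_and]
    exact ⟨e i, hi, _, Or.inl (hev i)⟩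
  have heright : ∀ i, e i ∈ C → v (i + 1) ∈ vertsOf val ed C := fun i hi => by
    simp only [vertsOf, Finset.mem_filter, Finset.mem_univ, true_and]
    exact ⟨e i, hi, _, Or.inr (hev i)⟩
  have hesurj : ∀ d ∈ D, ∃ i, e i = d := fun d hd => by
    have : val d ∈ Set.range (walkEdge ed v) := hD ▸ ⟨d, hd, rfl⟩
    obtain ⟨i, hi⟩ := this
    exact ⟨i, h.val_injective ((hev i).trans hi)⟩
  have hexit : ∃ i, v i ∈ vertsOf val ed C ∧ e i ∉ C := by
    by_contra! hcon
    obtain ⟨d, hd⟩ := hCD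
    obtain ⟨j, rfl⟩ := hesurj d (Finset.mem_inter.1 hd).2
    have hall : ∀ i, v i ∈ vertsOf val ed C :=
      ZMod.forall_of_add_one j (heleft j (Finset.mem_inter.1 hd).1)
        fun i hi => heright i (hcon i hi)
    have hsub : D ⊆ C := fun d hd => by
      obtain ⟨i, rfl⟩ := hesurj d hd
      exact hcon i (hall i)
    have h1 : Set.range (walkEdge ed v) ⊆ Set.range (walkEdge ed u) := by
      rw [← hD, ← hC]
      exact Set.image_mono (Finset.coe_subset.2 hsub)
    have h3 := h1.antisymm (h.range_subset hk hl hu hv h1)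
    rw [← hD, ← hC] at h3
    exact hne (Finset.coe_injective (h.val_injective.image_injective h3))
  obtain ⟨i₀, hi₀, hi₀'⟩ := hexit
  let J : Finset (ZMod l) := {i | v i ∉ vertsOf val ed C}
  have hJ : vertsOf val ed D \ vertsOf val ed C = J.image v := by
    ext x
    simp only [Finset.mem_sdiff, h.mem_vertsOf hD, Finset.mem_image, J, Finset.mem_filter,
      Finset.mem_univ, true_and]
    constructor
    · rintro ⟨⟨i, rfl⟩, hx⟩
      exact ⟨i, hx, rfl⟩
    · rintro ⟨i, hx, rfl⟩
      exact ⟨⟨i, rfl⟩, hx⟩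
  have hi₀J : i₀ ∉ J := by simp [J, hi₀]
  rw [hJ, Finset.card_image_of_injective _ hv, ← Finset.card_insert_of_notMem hi₀J,
    ← Finset.card_image_of_injective _ heinj]
  refine Finset.card_le_card fun d hd => ?_
  obtain ⟨i, hi, rfl⟩ := Finset.mem_image.1 hd
  refine Finset.mem_sdiff.2 ⟨heD i, ?_⟩
  rcases Finset.mem_insert.1 hi with rfl | hi
  · exact hi₀'
  · exact fun hc => (Finset.mem_filter.1 hi).2 (heleft i hc)

variable [Fintype E]

open Classical in
/-- Counting cycles of length `k` by their vertex sequences. -/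
theorem IsEdgeMap.sum_prod_verts_le (h : IsEdgeMap val ed k₀) (g : V → ℝ≥0∞) (k : ℕ) :
    ∑ C : Finset E with C ∈ cyclesOf val ed k₀ ∧ C.card = k, ∏ x ∈ vertsOf val ed C, g x ≤
      (∑ x, g x) ^ k := by
  rcases Nat.eq_zero_or_pos k with rfl | hk
  · rw [Finset.sum_eq_zero]
    · exact zero_le
    · intro C hC
      obtain ⟨hC, h0⟩ := (Finset.mem_filter.1 hC).2
      exact absurd h0 (Finset.card_pos.2 (h.nonempty hC)).ne'
  have : NeZero k := ⟨hk.ne'⟩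
  rcases isEmpty_or_nonempty V with hV | hV
  · rw [Finset.sum_eq_zero]
    · exact zero_le
    · intro C hC
      obtain ⟨l, hl, v, -⟩ := (Finset.mem_filter.1 hC).2.1
      exact isEmptyElim (v 0)
  have hex : ∀ C : Finset E, C ∈ cyclesOf val ed k₀ ∧ C.card = k → ∃ v : ZMod k → V,
      Function.Injective v ∧ val '' (C : Set E) = Set.range (walkEdge ed v) := by
    rintro C ⟨⟨l, hl, v, hv, hC⟩, hcard⟩
    have : l = k := by rw [← hcard, h.card_eq hl hv hC]
    subst this
    exact ⟨v, hv, hC⟩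
  choose! v hv hvC using hex
  have hpow : (∑ x, g x) ^ k = ∑ p : ZMod k → V, ∏ i, g (p i) := by
    rw [← Fintype.prod_sum, Finset.prod_const, Finset.card_univ, ZMod.card]
  rw [hpow]
  have hinj : Set.InjOn v (({C : Finset E | C ∈ cyclesOf val ed k₀ ∧ C.card = k} : Finset _) :
      Set (Finset E)) := by
    intro C hC D hD hCD
    have h1 := hvC C (Finset.mem_filter.1 (Finset.mem_coe.1 hC)).2
    have h2 := hvC D (Finset.mem_filter.1 (Finset.mem_coe.1 hD)).2
    rw [hCD, ← h2] at h1
    exact Finset.coe_injective (h.val_injective.image_injective h1)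
  calc _ = ∑ C : Finset E with C ∈ cyclesOf val ed k₀ ∧ C.card = k, ∏ i, g (v C i) := by
        refine Finset.sum_congr rfl fun C hC => ?_
        have hC' := (Finset.mem_filter.1 hC).2
        have himg : vertsOf val ed C = Finset.univ.image (v C) := by
          ext x
          simp [h.mem_vertsOf (hvC C hC')]
        rw [himg, Finset.prod_image fun i _ j _ hij => hv C hC' hij]
    _ = ∑ p ∈ ({C : Finset E | C ∈ cyclesOf val ed k₀ ∧ C.card = k} : Finset _).image v,
          ∏ i, g (p i) := by rw [Finset.sum_image hinj]
    _ ≤ _ := Finset.sum_le_sum_of_subset (Finset.subset_univ _)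

open Classical in
/-- The weighted number of pairs of short cycles that share an edge. -/
theorem IsEdgeMap.sum_pairs_le (h : IsEdgeMap val ed k₀) {q : ℝ≥0∞}
    (hq : (Fintype.card V : ℝ≥0∞) * q = 1) (L : ℕ) :
    ∑ C : Finset E with C ∈ cyclesOf val ed k₀ ∧ C.card ≤ L, q ^ C.card *
      ∑ D : Finset E with D ∈ cyclesOf val ed k₀ ∧ D.card ≤ L,
        q ^ ((vertsOf val ed D \ vertsOf val ed C).card + 1) ≤
      (L + 1) ^ 2 * ((L + 1) ^ L * q) := by
  have hinner : ∀ C : Finset E, C ∈ cyclesOf val ed k₀ → C.card ≤ L →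
      ∑ D : Finset E with D ∈ cyclesOf val ed k₀ ∧ D.card ≤ L,
        q ^ ((vertsOf val ed D \ vertsOf val ed C).card + 1) ≤ (L + 1) * ((L + 1) ^ L * q) := by
    intro C hC hCL
    rw [sum_filter_card_le]
    have hk : ∀ k ∈ Finset.range (L + 1),
        ∑ D : Finset E with D ∈ cyclesOf val ed k₀ ∧ D.card = k,
          q ^ ((vertsOf val ed D \ vertsOf val ed C).card + 1) ≤ (L + 1) ^ L * q := by
      intro k hk
      set A := vertsOf val ed C with hA
      have hprod : ∀ D : Finset E, q ^ ((vertsOf val ed D \ A).card + 1) =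
          (∏ x ∈ vertsOf val ed D, if x ∈ A then 1 else q) * q := fun D => by
        rw [pow_succ, Finset.prod_ite, Finset.prod_const_one, one_mul, Finset.prod_const,
          Finset.filter_notMem_eq_sdiff]
      simp only [hprod]
      rw [← Finset.sum_mul]
      gcongr
      refine (h.sum_prod_verts_le _ k).trans ?_
      have hsum : ∑ x : V, (if x ∈ A then 1 else q) ≤ (L + 1 : ℝ≥0∞) := by
        calc ∑ x : V, (if x ∈ A then 1 else q) ≤ ∑ x : V, ((if x ∈ A then 1 else 0) + q) := by
              refine Finset.sum_le_sum fun x _ => ?_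
              split_ifs <;> simp
          _ = A.card + 1 := by
              rw [Finset.sum_add_distrib, Finset.sum_const, Finset.card_univ, nsmul_eq_mul, hq]
              simp
          _ ≤ _ := by
              gcongr
              rw [hA, h.card_verts hC]
              exact hCL
      calc _ ≤ (L + 1 : ℝ≥0∞) ^ k := by gcongr
        _ ≤ _ := pow_le_pow_right₀ (by simp) (by have := Finset.mem_range.1 hk; omega)
    refine (Finset.sum_le_card_nsmul _ _ _ hk).trans_eq ?_
    rw [Finset.card_range, nsmul_eq_mul]
    push_cast
    rfl
  have houter : ∑ C : Finset E with C ∈ cyclesOf val ed k₀ ∧ C.card ≤ L, q ^ C.card ≤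
      (L + 1 : ℝ≥0∞) := by
    rw [sum_filter_card_le]
    have hk : ∀ k ∈ Finset.range (L + 1),
        ∑ C : Finset E with C ∈ cyclesOf val ed k₀ ∧ C.card = k, q ^ C.card ≤ 1 := by
      intro k hk
      calc _ = ∑ C : Finset E with C ∈ cyclesOf val ed k₀ ∧ C.card = k,
            ∏ x ∈ vertsOf val ed C, q := by
            refine Finset.sum_congr rfl fun C hC => ?_
            rw [Finset.prod_const, h.card_verts (Finset.mem_filter.1 hC).2.1]
        _ ≤ (∑ x : V, q) ^ k := h.sum_prod_verts_le _ k
        _ = 1 := by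
            rw [Finset.sum_const, Finset.card_univ, nsmul_eq_mul, hq, one_pow]
    refine (Finset.sum_le_card_nsmul _ _ _ hk).trans_eq ?_
    simp
  calc _ ≤ ∑ C : Finset E with C ∈ cyclesOf val ed k₀ ∧ C.card ≤ L,
        q ^ C.card * ((L + 1) * ((L + 1) ^ L * q)) := by
        refine Finset.sum_le_sum fun C hC => ?_
        obtain ⟨h1, h2⟩ := (Finset.mem_filter.1 hC).2
        gcongr
        exact hinner C h1 h2
    _ ≤ (L + 1) * ((L + 1) * ((L + 1) ^ L * q)) := by
        rw [← Finset.sum_mul]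
        gcongr
    _ = _ := by ring

end Counting

end Cycles

/-! ### Light cycles as a sum of dependent points -/

section LightCycles

variable {E : Type*}

/-- The point that records the light cycle `C`. -/
noncomputable def lightPoint (n : ℕ) (c₀ : ℝ) (C : Finset E) (w : E → ℝ) :
    Measure (Finset E × ℝ) :=
  optPoint {w | IsLight n w c₀ C} (fun w => (C, (n : ℝ) * meanWeight w C)) w

theorem measurable_point (n : ℕ) (C : Finset E) :
    Measurable fun w : E → ℝ => (C, (n : ℝ) * meanWeight w C) :=
  measurable_const.prodMk ((measurable_meanWeight C).const_mul _)

theorem measurable_lightPoint (n : ℕ) (c₀ : ℝ) (C : Finset E) :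
    Measurable (lightPoint n c₀ C) :=
  measurable_optPoint (measurableSet_isLight n c₀ C) (measurable_point n C)

theorem lightPoint_congr (n : ℕ) (c₀ : ℝ) {C : Finset E} {w w' : E → ℝ}
    (h : ∀ e ∈ C, w e = w' e) : lightPoint n c₀ C w = lightPoint n c₀ C w' := by
  have hm : meanWeight w C = meanWeight w' C := by
    rw [meanWeight, meanWeight, Finset.sum_congr rfl h]
  simp only [lightPoint, optPoint, Set.mem_ofPred_eq, IsLight, hm]
  congr

variable [Fintype E]

open Classical in
theorem lightCycles_eq_sum (𝒞 : Set (Finset E)) (n : ℕ) (c₀ : ℝ) (w : E → ℝ) :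
    lightCycles 𝒞 n c₀ w =
      ∑ C : Finset E with C ∈ 𝒞 ∧ (C.card : ℝ) ≤ shortLength n, lightPoint n c₀ C w := by
  simp only [lightCycles, lightPoint, optPoint, Set.mem_ofPred_eq, ← and_assoc]
  rw [← Finset.filter_filter, Finset.sum_filter]

open Classical in
theorem lightIntensity_eq_sum (𝒞 : Set (Finset E)) (n : ℕ) (c₀ : ℝ) :
    lightIntensity 𝒞 n c₀ =
      ∑ C : Finset E with C ∈ 𝒞 ∧ (C.card : ℝ) ≤ shortLength n,
        pointIntensity (weightLaw E) {w | IsLight n w c₀ C}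
          (fun w => (C, (n : ℝ) * meanWeight w C)) := by
  ext B hB
  rw [lightIntensity_apply 𝒞 n c₀ hB, Measure.coe_finsetSum, Finset.sum_apply]
  simp only [lightCycles_eq_sum, Measure.coe_finsetSum, Finset.sum_apply]
  have hm : ∀ C : Finset E, Measurable fun w => lightPoint n c₀ C w B := fun C =>
    (Measure.measurable_coe hB).comp (measurable_lightPoint n c₀ C)
  rw [lintegral_finsetSum _ fun C _ => hm C]
  refine Finset.sum_congr rfl fun C _ => ?_
  have hV := measurableSet_isLight n c₀ C
  have hf := measurable_point n C
  rw [pointIntensity, Measure.map_apply hf hB, Measure.restrict_apply (hf hB),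
    ← lintegral_indicator_one ((hf hB).inter hV)]
  refine lintegral_congr fun w => ?_
  by_cases hw : IsLight n w c₀ C
  · by_cases hB' : (C, (n : ℝ) * meanWeight w C) ∈ B
    · simp [lightPoint, optPoint, hw, hB', Measure.dirac_apply' _ hB]
    · simp [lightPoint, optPoint, hw, hB', Measure.dirac_apply' _ hB]
  · simp [lightPoint, optPoint, hw]

/-- The points of edge-disjoint families of cycles are independent. -/
theorem indepFun_sum_lightPoint [DecidableEq E] (n : ℕ) (c₀ : ℝ) (C : Finset E)
    (T : Finset (Finset E)) (hT : ∀ D ∈ T, ¬ (C ∩ D).Nonempty) :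
    IndepFun (fun w => ∑ D ∈ T, lightPoint n c₀ D w) (lightPoint n c₀ C) (weightLaw E) := by
  have hind : iIndepFun (fun (e : E) (w : E → ℝ) => w e) (weightLaw E) :=
    iIndepFun_pi (X := fun _ x => x) fun _ => aemeasurable_id
  have hdisj : Disjoint (T.biUnion id) C := by
    rw [Finset.disjoint_biUnion_left]
    intro D hD
    rw [disjoint_comm, Finset.disjoint_iff_inter_eq_empty]
    exact Finset.not_nonempty_iff_eq_empty.1 (hT D hD)
  have h1 := hind.indepFun_finset _ _ hdisj fun e => measurable_pi_apply e
  let ext : (S : Finset E) → (S → ℝ) → E → ℝ := fun S y e => if h : e ∈ S then y ⟨e, h⟩ else 0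
  have hext : ∀ S, Measurable (ext S) := fun S => by
    refine measurable_pi_lambda _ fun e => ?_
    by_cases h : e ∈ S
    · simpa [ext, h] using measurable_pi_apply _
    · simp [ext, h]
  have h2 := h1.comp
    (φ := fun y => ∑ D ∈ T, lightPoint n c₀ D (ext (T.biUnion id) y))
    (ψ := fun y => lightPoint n c₀ C (ext C y))
    (Finset.measurable_sum _ fun D _ => (measurable_lightPoint n c₀ D).comp (hext _))
    ((measurable_lightPoint n c₀ C).comp (hext _))
  refine (IndepFun.congr h2 (Eventually.of_forall fun w => ?_) (Eventually.of_forall fun w => ?_))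
  · refine Finset.sum_congr rfl fun D hD => lightPoint_congr n c₀ fun e he => ?_
    have : e ∈ T.biUnion id := Finset.mem_biUnion.2 ⟨D, hD, he⟩
    simp only [ext, this, dif_pos]
  · exact lightPoint_congr n c₀ fun e he => by simp only [ext, he, dif_pos]

variable {V T : Type*} [Fintype V] {val : E → T} {ed : V → V → T} {k₀ : ℕ}

open Classical in
/-- The error of the Poisson approximation, in terms of the number of pairs of cycles. -/
theorem IsEdgeMap.error_le (h : IsEdgeMap val ed k₀) {n : ℕ} (hn : 0 < n)
    (hV : Fintype.card V = n) (c₀ : ℝ) {L : ℕ} {s : Finset (Finset E)}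
    (hs : ∀ C ∈ s, C ∈ cyclesOf val ed k₀ ∧ C.card ≤ L) :
    ∑ C ∈ s, (weightLaw E {w | IsLight n w c₀ C} ^ 2 +
      2 * ∑ D ∈ s with D ≠ C ∧ (C ∩ D).Nonempty,
        (weightLaw E {w | IsLight n w c₀ C} * weightLaw E {w | IsLight n w c₀ D} +
          weightLaw E ({w | IsLight n w c₀ C} ∩ {w | IsLight n w c₀ D}))) ≤
    4 * ENNReal.ofReal (Real.exp (|c₀| * (2 * L))) ^ 2 *
      ((L + 1) ^ 2 * ((L + 1) ^ L * ENNReal.ofReal (n : ℝ)⁻¹)) := by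
  set q := ENNReal.ofReal (n : ℝ)⁻¹ with hq
  set K := ENNReal.ofReal (Real.exp (|c₀| * (2 * L))) with hK
  have hn' : (0 : ℝ) < n := by exact_mod_cast hn
  have hq1 : q ≤ 1 := by
    rw [hq, ENNReal.ofReal_le_one]
    exact inv_le_one_of_one_le₀ (by exact_mod_cast hn)
  have hnq : (Fintype.card V : ℝ≥0∞) * q = 1 := by
    rw [hV, hq, ← ENNReal.ofReal_natCast, ← ENNReal.ofReal_mul hn'.le,
      mul_inv_cancel₀ hn'.ne', ENNReal.ofReal_one]
  have hK1 : 1 ≤ K := by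
    rw [hK, ENNReal.one_le_ofReal, Real.one_le_exp_iff]
    positivity
  have hpair : ∀ C ∈ s, ∀ D ∈ s,
      weightLaw E ({w | IsLight n w c₀ C} ∩ {w | IsLight n w c₀ D}) ≤ K * q ^ (C ∪ D).card := by
    intro C hC D hD
    refine (weightLaw_isLight_inter_le hn c₀ (h.nonempty (hs C hC).1)
      (h.nonempty (hs D hD).1)).trans ?_
    refine mul_le_mul_left (ENNReal.ofReal_le_ofReal (Real.exp_le_exp.2 ?_)) _
    have h1 : (C.card : ℝ) ≤ L := by exact_mod_cast (hs C hC).2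
    have h2 : (D.card : ℝ) ≤ L := by exact_mod_cast (hs D hD).2
    calc c₀ * (C.card + D.card) ≤ |c₀| * (C.card + D.card) := by
          gcongr; exact le_abs_self c₀
      _ ≤ |c₀| * (2 * L) := by gcongr; linarith
  have hsingle : ∀ C ∈ s, weightLaw E {w | IsLight n w c₀ C} ≤ K * q ^ C.card := by
    intro C hC
    simpa using hpair C hC C hC
  have hcard : ∀ C ∈ s, ∀ D ∈ s, D ≠ C → (C ∩ D).Nonempty →
      (vertsOf val ed D \ vertsOf val ed C).card + 1 ≤ (D \ C).card := fun C hC D hD hne hCD =>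
    h.card_verts_sdiff_lt (hs C hC).1 (hs D hD).1 hne hCD
  set r : Finset E → Finset E → ℝ≥0∞ := fun C D =>
    q ^ ((vertsOf val ed D \ vertsOf val ed C).card + 1) with hr
  have hterm : ∀ C ∈ s, weightLaw E {w | IsLight n w c₀ C} ^ 2 +
      2 * ∑ D ∈ s with D ≠ C ∧ (C ∩ D).Nonempty,
        (weightLaw E {w | IsLight n w c₀ C} * weightLaw E {w | IsLight n w c₀ D} +
          weightLaw E ({w | IsLight n w c₀ C} ∩ {w | IsLight n w c₀ D})) ≤
      4 * K ^ 2 * (q ^ C.card * ∑ D ∈ s, r C D) := by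
    intro C hC
    have hA : weightLaw E {w | IsLight n w c₀ C} ^ 2 ≤ 4 * K ^ 2 * (q ^ C.card * r C C) := by
      calc _ ≤ (K * q ^ C.card) ^ 2 := by gcongr; exact hsingle C hC
        _ = 1 * K ^ 2 * (q ^ C.card * q ^ C.card) := by ring
        _ ≤ 4 * K ^ 2 * (q ^ C.card * r C C) := by
            gcongr
            · norm_num
            · simp only [hr]
              refine pow_le_pow_right_of_le_one' hq1 ?_
              rw [sdiff_self]
              exact Finset.card_pos.2 (h.nonempty (hs C hC).1)
    have hB : ∀ D ∈ s, D ≠ C → (C ∩ D).Nonempty →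
        weightLaw E {w | IsLight n w c₀ C} * weightLaw E {w | IsLight n w c₀ D} +
          weightLaw E ({w | IsLight n w c₀ C} ∩ {w | IsLight n w c₀ D}) ≤
        2 * K ^ 2 * (q ^ C.card * r C D) := by
      intro D hD hne hCD
      have hc := hcard C hC D hD hne hCD
      have hd : q ^ D.card ≤ r C D := pow_le_pow_right_of_le_one' hq1
        (hc.trans (Finset.card_le_card Finset.sdiff_subset))
      have hd' : q ^ (D \ C).card ≤ r C D := pow_le_pow_right_of_le_one' hq1 hc
      have hcu : (C ∪ D).card = C.card + (D \ C).card := by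
        rw [← Finset.union_sdiff_self_eq_union, Finset.card_union_of_disjoint Finset.disjoint_sdiff]
      calc _ ≤ (K * q ^ C.card) * (K * q ^ D.card) + K * q ^ (C ∪ D).card := by
            gcongr
            exacts [hsingle C hC, hsingle D hD, hpair C hC D hD]
        _ = K ^ 2 * (q ^ C.card * q ^ D.card) + K * (q ^ C.card * q ^ (D \ C).card) := by
            rw [hcu, pow_add]; ring
        _ ≤ K ^ 2 * (q ^ C.card * r C D) + K ^ 2 * (q ^ C.card * r C D) := by
            gcongr
            exact le_self_pow₀ hK1 two_ne_zero
        _ = _ := by ring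
    have hsub : insert C (s.filter fun D => D ≠ C ∧ (C ∩ D).Nonempty) ⊆ s :=
      Finset.insert_subset hC (Finset.filter_subset _ _)
    calc _ ≤ 4 * K ^ 2 * (q ^ C.card * r C C) +
          2 * ∑ D ∈ s with D ≠ C ∧ (C ∩ D).Nonempty, 2 * K ^ 2 * (q ^ C.card * r C D) := by
          gcongr with D hD
          obtain ⟨h1, h2, h3⟩ := Finset.mem_filter.1 hD
          exact hB D h1 h2 h3
      _ = 4 * K ^ 2 * (q ^ C.card *
          ∑ D ∈ insert C (s.filter fun D => D ≠ C ∧ (C ∩ D).Nonempty), r C D) := by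
          rw [Finset.sum_insert (by simp), ← Finset.mul_sum, ← Finset.mul_sum]
          ring
      _ ≤ _ := by gcongr
  have hsub : s ⊆ Finset.univ.filter fun C : Finset E => C ∈ cyclesOf val ed k₀ ∧ C.card ≤ L :=
    fun C hC => Finset.mem_filter.2 ⟨Finset.mem_univ _, hs C hC⟩
  calc _ ≤ ∑ C ∈ s, 4 * K ^ 2 * (q ^ C.card * ∑ D ∈ s, r C D) := Finset.sum_le_sum hterm
    _ = 4 * K ^ 2 * ∑ C ∈ s, q ^ C.card * ∑ D ∈ s, r C D := by rw [Finset.mul_sum]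
    _ ≤ 4 * K ^ 2 * ∑ C : Finset E with C ∈ cyclesOf val ed k₀ ∧ C.card ≤ L, q ^ C.card *
          ∑ D : Finset E with D ∈ cyclesOf val ed k₀ ∧ D.card ≤ L, r C D := by
        refine mul_le_mul_right ((Finset.sum_le_sum_of_subset hsub).trans
          (Finset.sum_le_sum fun C _ => ?_)) _
        gcongr
    _ ≤ _ := by
        gcongr
        exact h.sum_pairs_le hnq L

end LightCycles

/-- The error bound tends to zero. -/
theorem eventually_error_le (c₀ : ℝ) {ε : ℝ} (hε : 0 < ε) :
    ∀ᶠ n : ℕ in atTop, 0 < n ∧ 0 ≤ shortLength n ∧ ∀ L : ℕ, (L : ℝ) ≤ shortLength n →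
      4 * ENNReal.ofReal (Real.exp (|c₀| * (2 * L))) ^ 2 *
        ((L + 1) ^ 2 * ((L + 1) ^ L * ENNReal.ofReal (n : ℝ)⁻¹)) ≤ ENNReal.ofReal ε := by
  have hlog : Tendsto (fun n : ℕ => Real.log n) atTop atTop :=
    Real.tendsto_log_atTop.comp tendsto_natCast_atTop_atTop
  have h1 : ∀ᶠ x : ℝ in atTop, 2 ≤ x ∧ 1 ≤ Real.log x ∧ 16 * |c₀| ≤ Real.log x ∧
      x ^ 2 ≤ Real.exp (x / 8) ∧ 4 * Real.exp (-(x / 4)) ≤ ε := by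
    have e1 : ∀ᶠ x : ℝ in atTop, x ^ 2 ≤ Real.exp (x / 8) := by
      have := (isLittleO_pow_exp_pos_mul_atTop (b := 1 / 8) 2 (by norm_num)).bound one_pos
      filter_upwards [this] with x hx
      rw [one_mul, Real.norm_of_nonneg (by positivity), Real.norm_of_nonneg (by positivity)] at hx
      rwa [div_eq_inv_mul, ← one_div]
    have e2 : Tendsto (fun x : ℝ => 4 * Real.exp (-(x / 4))) atTop (nhds (4 * 0)) := by
      refine Tendsto.const_mul 4 (Real.tendsto_exp_neg_atTop_nhds_zero.comp ?_)
      exact tendsto_id.atTop_div_const (by norm_num)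
    rw [mul_zero] at e2
    filter_upwards [eventually_ge_atTop 2, Real.tendsto_log_atTop.eventually_ge_atTop 1,
      Real.tendsto_log_atTop.eventually_ge_atTop (16 * |c₀|), e1, e2.eventually_le_const hε]
      with x a b c d e
    exact ⟨a, b, c, d, e⟩
  filter_upwards [hlog.eventually h1, eventually_gt_atTop 0] with n ⟨hx2, hl1, hlc, hsq, hfin⟩ hn
  refine ⟨hn, div_nonneg (by linarith) (by linarith), fun L hL => ?_⟩
  have hn' : (0 : ℝ) < n := by exact_mod_cast hn
  set x := Real.log n with hx
  have hL0 : (0 : ℝ) ≤ L := by positivity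
  have hLx : L * Real.log x ≤ x / 2 := by
    rw [shortLength, ← hx, le_div_iff₀ (by linarith)] at hL
    linarith
  have hL1 : (L + 1 : ℝ) ≤ x := by nlinarith
  have hx0 : 0 < x := by linarith
  have hpow : (L + 1 : ℝ) ^ L ≤ Real.exp (x / 2) := by
    calc (L + 1 : ℝ) ^ L ≤ x ^ L := by gcongr
      _ = Real.exp (L * Real.log x) := by
          rw [mul_comm, Real.exp_mul, Real.exp_log hx0, Real.rpow_natCast]
      _ ≤ _ := Real.exp_le_exp.2 hLx
  have hexp : Real.exp (|c₀| * (2 * L)) ^ 2 ≤ Real.exp (x / 8) := by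
    rw [← Real.exp_nat_mul, Real.exp_le_exp]
    push_cast
    nlinarith [mul_le_mul_of_nonneg_left hlc hL0]
  have hinv : (n : ℝ)⁻¹ = Real.exp (-x) := by
    rw [Real.exp_neg, hx, Real.exp_log hn']
  have hreal : 4 * Real.exp (|c₀| * (2 * L)) ^ 2 *
      ((L + 1 : ℝ) ^ 2 * ((L + 1 : ℝ) ^ L * (n : ℝ)⁻¹)) ≤ ε := by
    calc _ ≤ 4 * Real.exp (x / 8) * (Real.exp (x / 8) * (Real.exp (x / 2) * Real.exp (-x))) := by
          rw [hinv]
          gcongr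
          exact (pow_le_pow_left₀ (by positivity) hL1 2).trans hsq
      _ = 4 * Real.exp (-(x / 4)) := by
          rw [mul_assoc, ← Real.exp_add, ← Real.exp_add, ← Real.exp_add]
          ring_nf
      _ ≤ ε := hfin
  refine le_trans (le_of_eq ?_) (ENNReal.ofReal_le_ofReal hreal)
  have hc : (L + 1 : ℝ≥0∞) = ENNReal.ofReal (L + 1 : ℝ) := by
    rw [ENNReal.ofReal_add hL0 zero_le_one, ENNReal.ofReal_natCast, ENNReal.ofReal_one]
  rw [hc, ENNReal.ofReal_mul (by positivity), ENNReal.ofReal_mul (by positivity),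
    ENNReal.ofReal_mul (by positivity), ENNReal.ofReal_mul (by positivity),
    ENNReal.ofReal_pow (by positivity), ENNReal.ofReal_pow (by positivity),
    ENNReal.ofReal_pow (by positivity)]
  norm_num

/-! ### Poisson approximation of the light cycles -/

section Main

variable {E : Type*} [Fintype E]

open Classical in
/-- On the light cycles themselves, the counting identity of the coupling holds. -/
theorem ncard_isLight_eq (𝒞 : Set (Finset E)) {n : ℕ} (hn : 0 < n) {c₀ : ℝ} (w : E → ℝ) {k : ℕ}
    (hk : (k : ℝ) ≤ shortLength n) {c : ℝ} (hc : c ≤ c₀) :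
    (({C ∈ 𝒞 | C.card = k ∧ IsLight n w c C}.ncard : ℕ) : ℝ≥0∞) =
      lightCycles 𝒞 n c₀ w ({C ∈ 𝒞 | C.card = k} ×ˢ Set.Iic c) := by
  have hn' : (0 : ℝ) < n := by exact_mod_cast hn
  have hB : MeasurableSet ({C ∈ 𝒞 | C.card = k} ×ˢ Set.Iic c) :=
    (Set.toFinite _).measurableSet.prod measurableSet_Iic
  have hlight : ∀ C : Finset E, (n : ℝ) * meanWeight w C ≤ c ↔ IsLight n w c C := fun C => by
    rw [IsLight, le_div_iff₀ hn', mul_comm]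
  have hmono : ∀ C : Finset E, IsLight n w c C → IsLight n w c₀ C := fun C h =>
    le_trans h (by gcongr)
  rw [lightCycles, Measure.coe_finsetSum, Finset.sum_apply]
  simp only [Measure.dirac_apply' _ hB, Set.indicator_apply, Pi.one_apply, Set.mem_prod,
    Set.mem_Iic, hlight, Set.mem_ofPred_eq]
  rw [Finset.sum_boole, Finset.filter_filter, ← Set.ncard_coe_finset]
  congr 2
  ext C
  simp only [Set.mem_ofPred_eq, Finset.coe_filter, Finset.mem_univ, true_and]
  constructor
  · rintro ⟨h1, h2, h3⟩
    exact ⟨⟨h1, by rwa [h2], hmono C h3⟩, ⟨h1, h2⟩, h3⟩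
  · rintro ⟨-, ⟨h1, h2⟩, h3⟩
    exact ⟨h1, h2, h3⟩

variable {V T : Type*} [Fintype V] {val : E → T} {ed : V → V → T} {k₀ : ℕ}

theorem isFiniteMeasure_lightIntensity (𝒞 : Set (Finset E)) (n : ℕ) (c₀ : ℝ) :
    IsFiniteMeasure (lightIntensity 𝒞 n c₀) := by
  rw [lightIntensity_eq_sum]
  infer_instance

/-- The light cycles are close in law to some Poisson process with the same intensity. -/
theorem IsEdgeMap.exists_leUpTo (h : IsEdgeMap val ed k₀) {n : ℕ} (hn : 0 < n)
    (hV : Fintype.card V = n) (c₀ : ℝ) {ε : ℝ} (hL : 0 ≤ shortLength n)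
    (herr : ∀ L : ℕ, (L : ℝ) ≤ shortLength n →
      4 * ENNReal.ofReal (Real.exp (|c₀| * (2 * L))) ^ 2 *
        ((L + 1) ^ 2 * ((L + 1) ^ L * ENNReal.ofReal (n : ℝ)⁻¹)) ≤ ENNReal.ofReal ε) :
    ∃ Q, IsPoissonProcessLaw (lightIntensity (cyclesOf val ed k₀) n c₀) Q ∧
      LeUpTo ((weightLaw E).map (lightCycles (cyclesOf val ed k₀) n c₀)) Q (ENNReal.ofReal ε) := by
  classical
  have := isFiniteMeasure_lightIntensity (cyclesOf val ed k₀) n c₀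
  obtain ⟨Q, hQ, hle⟩ := exists_hasPoissonChar_leUpTo (weightLaw E)
    (fun C : Finset E => {w | IsLight n w c₀ C}) (measurableSet_isLight n c₀)
    (fun C w => (C, (n : ℝ) * meanWeight w C)) (measurable_point n)
    (fun C D => (C ∩ D).Nonempty) (fun C S hS => indepFun_sum_lightPoint n c₀ C S hS)
    {C : Finset E | C ∈ cyclesOf val ed k₀ ∧ (C.card : ℝ) ≤ shortLength n}
  rw [← lightIntensity_eq_sum] at hQ
  refine ⟨Q, hQ.isPoissonProcessLaw, fun A hA => ?_⟩
  have hfun : lightCycles (cyclesOf val ed k₀) n c₀ = fun w =>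
      ∑ C : Finset E with C ∈ cyclesOf val ed k₀ ∧ (C.card : ℝ) ≤ shortLength n,
        lightPoint n c₀ C w := funext fun w => lightCycles_eq_sum _ n c₀ w
  rw [hfun]
  refine (hle A hA).trans (add_le_add_right ?_ _)
  refine le_trans ?_ (herr ⌊shortLength n⌋₊ (Nat.floor_le hL))
  refine h.error_le hn hV c₀ fun C hC => ?_
  obtain ⟨h1, h2⟩ := (Finset.mem_filter.1 hC).2
  exact ⟨h1, Nat.le_floor h2⟩

end Main

theorem IsEdgeMap.poisson_approximation {E V T : Type} [Fintype E] [Fintype V] {val : E → T}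
    {ed : V → V → T} {k₀ : ℕ} (h : IsEdgeMap val ed k₀) {n : ℕ} (hn : 0 < n)
    (hV : Fintype.card V = n) (c₀ : ℝ) {ε : ℝ} (hε : 0 ≤ ε) (hL : 0 ≤ shortLength n)
    (herr : ∀ L : ℕ, (L : ℝ) ≤ shortLength n →
      4 * ENNReal.ofReal (Real.exp (|c₀| * (2 * L))) ^ 2 *
        ((L + 1) ^ 2 * ((L + 1) ^ L * ENNReal.ofReal (n : ℝ)⁻¹)) ≤ ENNReal.ofReal ε) :
    (∀ Q : Measure (Measure (Finset E × ℝ)),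
      IsPoissonProcessLaw (lightIntensity (cyclesOf val ed k₀) n c₀) Q →
        tvDist ((weightLaw E).map (lightCycles (cyclesOf val ed k₀) n c₀)) Q ≤ ε) ∧
    ∃ (Ω : Type) (_ : MeasurableSpace Ω) (P : Measure Ω) (W : Ω → E → ℝ)
      (η : Ω → Measure (Finset E × ℝ)),
      IsProbabilityMeasure P ∧ Measurable W ∧ Measurable η ∧
      P.map W = weightLaw E ∧
      IsPoissonProcessLaw (lightIntensity (cyclesOf val ed k₀) n c₀) (P.map η) ∧
      P {ω | ¬ ∀ k : ℕ, (k : ℝ) ≤ shortLength n → ∀ c : ℝ, c ≤ c₀ →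
          (({C ∈ cyclesOf val ed k₀ | C.card = k ∧ IsLight n (W ω) c C}.ncard : ℕ) : ℝ≥0∞) =
            η ω ({C ∈ cyclesOf val ed k₀ | C.card = k} ×ˢ Set.Iic c)}
        ≤ ENNReal.ofReal ε := by
  obtain ⟨Q₀, hQ₀, hle⟩ := h.exists_leUpTo hn hV c₀ hL herr
  have := isFiniteMeasure_lightIntensity (cyclesOf val ed k₀) n c₀
  have := hQ₀.isProbabilityMeasure
  have hF := measurable_lightCycles (cyclesOf val ed k₀) n c₀
  have := Measure.isProbabilityMeasure_map (μ := weightLaw E) hF.aemeasurable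
  refine ⟨fun Q hQ => ?_, ?_⟩
  · rw [hQ.unique hQ₀]
    exact hle.tvDist_le hε
  obtain ⟨P, hP, hPW, hPη, hbad⟩ := hle.exists_coupling hF
  have hb : MeasurableSet {ω : Bool × (E → ℝ) × Measure (Finset E × ℝ) | ω.1 = true} :=
    measurable_fst (measurableSet_singleton true)
  refine ⟨_, inferInstance, P, fun ω => ω.2.1,
    fun ω => if ω.1 then lightCycles (cyclesOf val ed k₀) n c₀ ω.2.1 else ω.2.2, hP,
    by fun_prop, Measurable.ite hb (hF.comp (by fun_prop)) (by fun_prop), hPW, by rwa [hPη], ?_⟩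
  refine (measure_mono fun ω hω => ?_).trans hbad
  by_contra htrue
  have htrue : ω.1 = true := by simpa using htrue
  refine hω fun k hk c hc => ?_
  simp only [htrue, if_true]
  exact ncard_isLight_eq _ hn _ hk hc

theorem mainTheorem3 (c₀ ε : ℝ) (hε : 0 < ε) :
    -- the complete directed graph
    (∀ᶠ n : ℕ in atTop,
      (∀ Q : Measure (Measure (Finset (DirEdge (Fin n)) × ℝ)),
        IsPoissonProcessLaw (lightIntensity (dirCycles (Fin n)) n c₀) Q →
          tvDist ((weightLaw (DirEdge (Fin n))).map (lightCycles (dirCycles (Fin n)) n c₀)) Q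
            ≤ ε) ∧
      ∃ (Ω : Type) (_ : MeasurableSpace Ω) (P : Measure Ω) (W : Ω → DirEdge (Fin n) → ℝ)
        (η : Ω → Measure (Finset (DirEdge (Fin n)) × ℝ)),
        IsProbabilityMeasure P ∧ Measurable W ∧ Measurable η ∧
        P.map W = weightLaw (DirEdge (Fin n)) ∧
        IsPoissonProcessLaw (lightIntensity (dirCycles (Fin n)) n c₀) (P.map η) ∧
        P {ω | ¬ ∀ k : ℕ, (k : ℝ) ≤ shortLength n → ∀ c : ℝ, c ≤ c₀ →
            (({C ∈ dirCycles (Fin n) | C.card = k ∧ IsLight n (W ω) c C}.ncard : ℕ) : ℝ≥0∞) =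
              η ω ({C ∈ dirCycles (Fin n) | C.card = k} ×ˢ Set.Iic c)}
          ≤ ENNReal.ofReal ε) ∧
    -- the complete undirected graph
    (∀ᶠ n : ℕ in atTop,
      (∀ Q : Measure (Measure (Finset (UndirEdge (Fin n)) × ℝ)),
        IsPoissonProcessLaw (lightIntensity (undirCycles (Fin n)) n c₀) Q →
          tvDist ((weightLaw (UndirEdge (Fin n))).map (lightCycles (undirCycles (Fin n)) n c₀)) Q
            ≤ ε) ∧
      ∃ (Ω : Type) (_ : MeasurableSpace Ω) (P : Measure Ω) (W : Ω → UndirEdge (Fin n) → ℝ)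
        (η : Ω → Measure (Finset (UndirEdge (Fin n)) × ℝ)),
        IsProbabilityMeasure P ∧ Measurable W ∧ Measurable η ∧
        P.map W = weightLaw (UndirEdge (Fin n)) ∧
        IsPoissonProcessLaw (lightIntensity (undirCycles (Fin n)) n c₀) (P.map η) ∧
        P {ω | ¬ ∀ k : ℕ, (k : ℝ) ≤ shortLength n → ∀ c : ℝ, c ≤ c₀ →
            (({C ∈ undirCycles (Fin n) | C.card = k ∧ IsLight n (W ω) c C}.ncard : ℕ) : ℝ≥0∞) =
              η ω ({C ∈ undirCycles (Fin n) | C.card = k} ×ˢ Set.Iic c)}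
          ≤ ENNReal.ofReal ε) := by
  refine ⟨?_, ?_⟩
  · filter_upwards [eventually_error_le c₀ hε] with n ⟨hn, hL, herr⟩
    exact isEdgeMap_dir.poisson_approximation hn (Fintype.card_fin n) c₀ hε.le hL herr
  · filter_upwards [eventually_error_le c₀ hε] with n ⟨hn, hL, herr⟩
    exact isEdgeMap_undir.poisson_approximation hn (Fintype.card_fin n) c₀ hε.le hL herr
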